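/- Let $\theta\in\mathbb{R}\setminus\mathbb{Q}$ be a quadratic irrational, i.e. an irrational real number whose minimal polynomial over $\mathbb{Q}$ has degree two. Then the following hold. (i) The simple continued fraction expansion $\theta=a_0+\cfrac{1}{a_1+\cfrac{1}{a_2+\cdots}}$ is eventually periodic; let $p\ge 1$ be its minimal period, and let $\ell$ be the least even period length, that is, $\ell=p$ if $p$ is even and $\ell=2p$ if $p$ is odd. (ii) With $q_n$ the denominator of the $n$-th convergent of $\theta$, the Lévy constant $\beta(\theta)=\lim_{n\to\infty}\frac1n\log q_n$ exists. (iii) There is a prime hyperbolic element of $\mathrm{PSL}(2,\mathbb{Z})$ (that is, a hyperbolic element which is not a non-trivial power of another hyperbolic element of $\mathrm{PSL}(2,\mathbb{Z})$) that fixes $\theta$ under the action by Möbius transformations, and it is unique up to inversion. (iv) Let $M_\theta\in\mathrm{SL}(2,\mathbb{Z})$ be any matrix representing such an element. The automorphism $f_\theta(x+\mathbb{Z}^2)=M_\theta x+\mathbb{Z}^2$ of the torus $\mathbb{R}^2/\mathbb{Z}^2$ is hyperbolic (no eigenvalue of $M_\theta$ lies on the unit circle), and its topological entropy is $$h_{\mathrm{top}}(f_\theta)=\ell\,\beta(\theta).$$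 -/

import Mathlib

open Filter Topology Matrix

noncomputable section

/-! ### Continued fractions -/

/-- `l` is an (eventual) period length of the simple continued fraction expansion
`θ = a₀ + 1/(a₁ + 1/(a₂ + ⋯))`: one has `l > 0` and `a_{n+l} = a_n` for all large `n`.
(For irrational `θ` the sequence of partial quotients is infinite; its entry with index `n`
in `partDens` is `a_{n+1}`.) -/
def IsEventualCFPeriod (θ : ℝ) (l : ℕ) : Prop :=
  0 < l ∧ ∃ k : ℕ, ∀ n ≥ k,
    (GenContFract.of θ).partDens.get? (n + l) = (GenContFract.of θ).partDens.get? n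

/-- `β` is the Lévy constant of `θ`: `β = lim (1/n) log q_n`, with `q_n` the denominator of the
`n`-th convergent of `θ` (in particular the limit exists). -/
def HasLevyConstant (θ β : ℝ) : Prop :=
  Tendsto (fun n : ℕ => (1 / (n : ℝ)) * Real.log ((GenContFract.of θ).dens.get n)) atTop (𝓝 β)

/-! ### Hyperbolic elements of the modular group -/

/-- The modular group `PSL(2, ℤ)`. -/
abbrev PSL2Z : Type := Matrix.ProjectiveSpecialLinearGroup (Fin 2) ℤ

/-- The class in `PSL(2, ℤ)` of a matrix of `SL(2, ℤ)`. -/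
def toPSL2Z : Matrix.SpecialLinearGroup (Fin 2) ℤ →* PSL2Z :=
  QuotientGroup.mk' _

/-- An element of `PSL(2, ℤ)` is hyperbolic if the matrices `± M` representing it are,
that is, if `(tr M)² - 4 det M > 0`. -/
def PSL2Z.IsHyperbolic (γ : PSL2Z) : Prop :=
  ∃ M : Matrix.SpecialLinearGroup (Fin 2) ℤ, toPSL2Z M = γ ∧
    (M : Matrix (Fin 2) (Fin 2) ℤ).IsHyperbolic

/-- A hyperbolic element of `PSL(2, ℤ)` is prime if it is not a non-trivial power of another
hyperbolic element. -/
def PSL2Z.IsPrimeHyperbolic (γ : PSL2Z) : Prop :=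
  PSL2Z.IsHyperbolic γ ∧
    ∀ (η : PSL2Z) (k : ℤ), PSL2Z.IsHyperbolic η → γ = η ^ k → k = 1 ∨ k = -1

/-- `γ` fixes the real number `θ` when acting by Möbius transformations.
(The denominator does not vanish when `θ` is irrational.) -/
def PSL2Z.Fixes (γ : PSL2Z) (θ : ℝ) : Prop :=
  ∃ M : Matrix.SpecialLinearGroup (Fin 2) ℤ, toPSL2Z M = γ ∧
    ((M 0 0 : ℝ) * θ + (M 0 1 : ℝ)) / ((M 1 0 : ℝ) * θ + (M 1 1 : ℝ)) = θ

/-- `γ` is a prime hyperbolic element of `PSL(2, ℤ)` associated to `θ`. -/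
def PSL2Z.IsPrimeHyperbolicOf (γ : PSL2Z) (θ : ℝ) : Prop :=
  PSL2Z.IsPrimeHyperbolic γ ∧ PSL2Z.Fixes γ θ

/-! ### Toral automorphisms -/

/-- The torus `ℝ² / ℤ²`. -/
abbrev Torus2 : Type := Fin 2 → UnitAddCircle

/-- The map `x + ℤ² ↦ M x + ℤ²` of the torus induced by an integer matrix `M`. -/
def toralMap (M : Matrix (Fin 2) (Fin 2) ℤ) (x : Torus2) : Torus2 :=
  fun i => ∑ j, M i j • x j

/-- The quotient map `ℝ² → ℝ² / ℤ²`. -/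
def toTorus2 (v : Fin 2 → ℝ) : Torus2 := fun i => (v i : UnitAddCircle)

theorem toralMap_toTorus2 (M : Matrix (Fin 2) (Fin 2) ℤ) (v : Fin 2 → ℝ) :
    toralMap M (toTorus2 v) = toTorus2 (M.map (Int.cast : ℤ → ℝ) *ᵥ v) := by
  funext i
  simp only [toralMap, toTorus2, Matrix.mulVec, dotProduct, Fin.sum_univ_two, Matrix.map_apply,
    AddCircle.coe_add, ← AddCircle.coe_zsmul, zsmul_eq_mul]

theorem toralMap_mul (M N : Matrix (Fin 2) (Fin 2) ℤ) (x : Torus2) :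
    toralMap (M * N) x = toralMap M (toralMap N x) := by
  funext i
  simp only [toralMap, Matrix.mul_apply, Fin.sum_univ_two, smul_add, add_smul, mul_smul]
  abel

theorem toralMap_one (x : Torus2) : toralMap 1 x = x := by
  funext i
  simp [toralMap, Matrix.one_apply, ite_smul]

theorem continuous_toralMap (M : Matrix (Fin 2) (Fin 2) ℤ) : Continuous (toralMap M) := by
  unfold toralMap
  fun_prop

/-- The automorphism `f_M` of the topological group `ℝ² / ℤ²` induced by `M ∈ SL(2, ℤ)`. -/
def toralAutomorphism (M : Matrix.SpecialLinearGroup (Fin 2) ℤ) : Torus2 ≃ₜ+ Torus2 where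
  toFun := toralMap (M : Matrix (Fin 2) (Fin 2) ℤ)
  invFun := toralMap ((M⁻¹ : Matrix.SpecialLinearGroup (Fin 2) ℤ) : Matrix (Fin 2) (Fin 2) ℤ)
  left_inv x := by
    rw [← toralMap_mul, ← Matrix.SpecialLinearGroup.coe_mul, inv_mul_cancel,
      Matrix.SpecialLinearGroup.coe_one, toralMap_one]
  right_inv x := by
    rw [← toralMap_mul, ← Matrix.SpecialLinearGroup.coe_mul, mul_inv_cancel,
      Matrix.SpecialLinearGroup.coe_one, toralMap_one]
  map_add' x y := by
    funext i
    simp only [toralMap, Pi.add_apply, smul_add, Finset.sum_add_distrib]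
  continuous_toFun := continuous_toralMap _
  continuous_invFun := continuous_toralMap _

/-- The toral automorphism induced by `M` is hyperbolic if no (complex) eigenvalue of `M`
lies on the unit circle. -/
def IsHyperbolicToral (M : Matrix.SpecialLinearGroup (Fin 2) ℤ) : Prop :=
  ∀ z ∈ spectrum ℂ ((M : Matrix (Fin 2) (Fin 2) ℤ).map (Int.cast : ℤ → ℂ)), ‖z‖ ≠ 1

/-- The topological entropy of a self-map of the (compact) torus. -/
def torusEntropy (f : Torus2 → Torus2) : EReal :=
  Dynamics.coverEntropy f Set.univ

end

/-! Everything is read off one group: the stabilizer in SL(2, ℤ) of the line spanned by (θ, 1). A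
matrix M in it multiplies (θ, 1) by `multiplier M θ`, and its eigenvalues are this number and its
inverse. Since θ is irrational, the multiplier determines M, and its absolute value determines the
class of M in PSL(2, ℤ).

The link to continued fractions is P_n (θ_n, 1) = Q_n (θ, 1), where P_n is the matrix of convergents
and Q_n = θ_1 ⋯ θ_n. If θ_{k+l} = θ_k with l even, then P_{k+l} P_k⁻¹ lies in the stabilizer, with
multiplier ε = Q_{k+l} / Q_k. Conversely, by Serret's argument (`exists_mul_convMatrix_eq`), every M
with positive multiplier satisfies M P_n = P_m for some n, m with θ_n = θ_m. Determinants force m -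
n to be even, so it is a multiple of ℓ, and the multiplier is a power of the ε belonging to ℓ. Hence
the stabilizer modulo ±1 is infinite cyclic, and its generator is the prime hyperbolic element.
Periodicity comes from the same source: a Pell equation supplies a non-trivial stabilizer element,
and Serret's argument turns it into a repetition.

Finally, q_n and Q_n agree up to a factor 2, and Q_n grows by ε in each ℓ steps, so β = (log ε) / ℓ.
The entropy of an automorphism with expanding eigenvalue ν is log |ν| (`coverEntropy_toralMap`), and
here |ν| = ε. -/

/-! ### Complete quotients and matrices of convergents. -/

/-- The complete quotients `θ_n` of the continued fraction expansion of `θ`. -/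
noncomputable def completeQuotient (θ : ℝ) : ℕ → ℝ
  | 0 => θ
  | n + 1 => (Int.fract (completeQuotient θ n))⁻¹

/-- The matrix of the Möbius transformation `x ↦ a + 1 / x`. -/
def cfMatrix (a : ℤ) : Matrix (Fin 2) (Fin 2) ℤ := !![a, 1; 1, 0]

/-- The matrix with columns the `(n-1)`-st and `(n-2)`-nd convergents of `θ`. -/
noncomputable def convMatrix (θ : ℝ) : ℕ → Matrix (Fin 2) (Fin 2) ℤ
  | 0 => 1
  | n + 1 => convMatrix θ n * cfMatrix ⌊completeQuotient θ n⌋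

/-- The product `θ_1 ⋯ θ_n` of complete quotients. -/
noncomputable def quotientProd (θ : ℝ) (n : ℕ) : ℝ :=
  ∏ i ∈ Finset.range n, completeQuotient θ (i + 1)

theorem completeQuotient_add (θ : ℝ) (m n : ℕ) :
    completeQuotient θ (m + n) = completeQuotient (completeQuotient θ m) n := by
  induction n with
  | zero => rfl
  | succ n ih => rw [← add_assoc, completeQuotient, completeQuotient, ih]

theorem completeQuotient_succ' (θ : ℝ) (n : ℕ) :
    completeQuotient θ (n + 1) = completeQuotient (Int.fract θ)⁻¹ n := by
  rw [add_comm, completeQuotient_add]; rfl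

theorem convMatrix_succ' (θ : ℝ) (n : ℕ) :
    convMatrix θ (n + 1) = cfMatrix ⌊θ⌋ * convMatrix (Int.fract θ)⁻¹ n := by
  induction n with
  | zero => simp [convMatrix, completeQuotient]
  | succ n ih => rw [convMatrix, ih, convMatrix, Matrix.mul_assoc, completeQuotient_succ']

theorem irrational_completeQuotient {θ : ℝ} (hθ : Irrational θ) (n : ℕ) :
    Irrational (completeQuotient θ n) := by
  induction n with
  | zero => exact hθ
  | succ n ih =>
    rw [completeQuotient, irrational_inv_iff, ← Int.self_sub_floor]
    exact ih.sub_intCast _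

theorem one_lt_completeQuotient_succ {θ : ℝ} (hθ : Irrational θ) (n : ℕ) :
    1 < completeQuotient θ (n + 1) := by
  have h := irrational_completeQuotient hθ n
  have h0 : Int.fract (completeQuotient θ n) ≠ 0 := by
    intro h0
    have := h.sub_intCast ⌊completeQuotient θ n⌋
    rw [Int.self_sub_floor] at this
    exact this.ne_zero h0
  exact (one_lt_inv₀ (lt_of_le_of_ne (Int.fract_nonneg _) h0.symm)).2 (Int.fract_lt_one _)

theorem one_le_floor_completeQuotient_succ {θ : ℝ} (hθ : Irrational θ) (n : ℕ) :
    1 ≤ ⌊completeQuotient θ (n + 1)⌋ := by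
  rw [Int.le_floor]; exact_mod_cast (one_lt_completeQuotient_succ hθ n).le

theorem completeQuotient_eq (θ : ℝ) (n : ℕ) :
    completeQuotient θ n =
      ⌊completeQuotient θ n⌋ + (completeQuotient θ (n + 1))⁻¹ := by
  rw [completeQuotient, inv_inv, Int.floor_add_fract]

theorem convMatrix_succ_apply_zero (θ : ℝ) (n : ℕ) (i : Fin 2) :
    convMatrix θ (n + 1) i 0 =
      convMatrix θ n i 0 * ⌊completeQuotient θ n⌋ + convMatrix θ n i 1 := by
  simp [convMatrix, cfMatrix, Matrix.mul_apply, Fin.sum_univ_two]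

theorem convMatrix_succ_apply_one (θ : ℝ) (n : ℕ) (i : Fin 2) :
    convMatrix θ (n + 1) i 1 = convMatrix θ n i 0 := by
  simp [convMatrix, cfMatrix, Matrix.mul_apply, Fin.sum_univ_two]

theorem det_convMatrix (θ : ℝ) (n : ℕ) : (convMatrix θ n).det = (-1) ^ n := by
  induction n with
  | zero => simp [convMatrix]
  | succ n ih => simp [convMatrix, ih, cfMatrix, pow_succ]

theorem quotientProd_succ (θ : ℝ) (n : ℕ) :
    quotientProd θ (n + 1) = quotientProd θ n * completeQuotient θ (n + 1) :=
  Finset.prod_range_succ _ _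

theorem quotientProd_pos {θ : ℝ} (hθ : Irrational θ) (n : ℕ) : 0 < quotientProd θ n :=
  Finset.prod_pos fun i _ => by linarith [one_lt_completeQuotient_succ hθ i]

/-- The relation `P_n (θ_n, 1) = (θ_1 ⋯ θ_n) (θ, 1)`. -/
theorem convMatrix_mul_completeQuotient {θ : ℝ} (hθ : Irrational θ) (n : ℕ) (i : Fin 2) :
    (convMatrix θ n i 0 : ℝ) * completeQuotient θ n + convMatrix θ n i 1 =
      quotientProd θ n * ![θ, 1] i := by
  induction n with
  | zero => fin_cases i <;> simp [convMatrix, completeQuotient, quotientProd, Matrix.one_apply]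
  | succ n ih =>
    have h1 := one_lt_completeQuotient_succ hθ n
    have h2 := completeQuotient_eq θ n
    rw [convMatrix_succ_apply_one, convMatrix_succ_apply_zero, quotientProd_succ,
      mul_right_comm, ← ih]
    have h3 : completeQuotient θ n * completeQuotient θ (n + 1) =
        ⌊completeQuotient θ n⌋ * completeQuotient θ (n + 1) + 1 := by
      nth_rewrite 1 [h2]
      rw [add_mul, inv_mul_cancel₀ (by linarith)]
    push_cast
    linear_combination -(convMatrix θ n i 0 : ℝ) * h3

/-! ### Comparison with `GenContFract.of`. -/

theorem intFractPair_stream_eq {θ : ℝ} (hθ : Irrational θ) (n : ℕ) :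
    GenContFract.IntFractPair.stream θ n =
      some (GenContFract.IntFractPair.of (completeQuotient θ n)) := by
  induction n with
  | zero => rfl
  | succ n ih =>
    refine GenContFract.IntFractPair.stream_succ_of_some ih fun h => ?_
    have := one_lt_completeQuotient_succ hθ n
    rw [completeQuotient] at this
    change Int.fract (completeQuotient θ n) = 0 at h
    rw [h] at this
    norm_num at this

theorem s_get?_eq {θ : ℝ} (hθ : Irrational θ) (n : ℕ) :
    (GenContFract.of θ).s.get? n = some ⟨1, (⌊completeQuotient θ (n + 1)⌋ : ℝ)⟩ :=
  GenContFract.get?_of_eq_some_of_succ_get?_intFractPair_stream (intFractPair_stream_eq hθ (n + 1))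

theorem partDens_get?_eq {θ : ℝ} (hθ : Irrational θ) (n : ℕ) :
    (GenContFract.of θ).partDens.get? n = some (⌊completeQuotient θ (n + 1)⌋ : ℝ) :=
  GenContFract.partDen_eq_s_b (s_get?_eq hθ n)

/-- The recurrence has order two, so two consecutive terms are carried through the induction. -/
theorem contsAux_b_eq {θ : ℝ} (hθ : Irrational θ) (n : ℕ) :
    ((GenContFract.of θ).contsAux n).b = convMatrix θ n 1 0 ∧
      ((GenContFract.of θ).contsAux (n + 1)).b = convMatrix θ (n + 1) 1 0 := by
  induction n with
  | zero => simp [convMatrix, cfMatrix]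
  | succ n ih =>
    refine ⟨ih.2, ?_⟩
    rw [GenContFract.contsAux_recurrence (s_get?_eq hθ n) rfl rfl]
    dsimp only
    rw [ih.1, ih.2, convMatrix_succ_apply_zero θ (n + 1), convMatrix_succ_apply_one]
    push_cast
    ring

/-- The denominators of the convergents, shifted by one. -/
theorem dens_eq_convMatrix {θ : ℝ} (hθ : Irrational θ) (n : ℕ) :
    (GenContFract.of θ).dens n = convMatrix θ (n + 1) 1 0 :=
  (contsAux_b_eq hθ n).2

/-- An irrational number is determined by its floor and its partial denominators. -/
theorem eq_of_floor_completeQuotient_eq {α β : ℝ} (hα : Irrational α) (hβ : Irrational β)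
    (h : ∀ n, ⌊completeQuotient α n⌋ = ⌊completeQuotient β n⌋) : α = β := by
  have key : GenContFract.of α = GenContFract.of β := by
    have hs : (GenContFract.of α).s = (GenContFract.of β).s :=
      Stream'.Seq.ext fun n => by rw [s_get?_eq hα, s_get?_eq hβ, h]
    have hh : (GenContFract.of α).h = (GenContFract.of β).h := by
      rw [GenContFract.of_h_eq_floor, GenContFract.of_h_eq_floor]
      exact_mod_cast h 0
    cases hA : GenContFract.of α
    cases hB : GenContFract.of β
    simp_all
  have h1 := GenContFract.of_convergence α
  have h2 := GenContFract.of_convergence β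
  rw [key] at h1
  exact tendsto_nhds_unique h1 h2

/-- A complete quotient is determined by the partial quotients from its index on, so periodicity
becomes a family of equations between real numbers. -/
theorem isEventualCFPeriod_iff {θ : ℝ} (hθ : Irrational θ) (l : ℕ) :
    IsEventualCFPeriod θ l ↔
      0 < l ∧ ∃ k, ∀ n ≥ k, completeQuotient θ (n + l) = completeQuotient θ n := by
  refine and_congr_right fun _ => ⟨?_, ?_⟩
  · rintro ⟨k, hk⟩
    -- The shift by one is needed because `partDens` starts at a_1: the floor of θ_0 is not among
    -- its entries.
    refine ⟨k + 1, fun n hn => ?_⟩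
    refine eq_of_floor_completeQuotient_eq (irrational_completeQuotient hθ _)
      (irrational_completeQuotient hθ _) fun m => ?_
    rw [← completeQuotient_add, ← completeQuotient_add]
    have := hk (n - 1 + m) (by omega)
    rw [partDens_get?_eq hθ, partDens_get?_eq hθ, Option.some_inj] at this
    rw [show n + l + m = n - 1 + m + l + 1 by omega, show n + m = n - 1 + m + 1 by omega]
    exact_mod_cast this
  · rintro ⟨k, hk⟩
    refine ⟨k, fun n hn => ?_⟩
    rw [partDens_get?_eq hθ, partDens_get?_eq hθ, add_right_comm, hk _ (by omega)]

/-! ### Growth of the denominators. -/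

theorem convMatrix_denom_mono {θ : ℝ} (hθ : Irrational θ) (n : ℕ) :
    0 ≤ convMatrix θ n 1 0 ∧ 1 ≤ convMatrix θ (n + 1) 1 0 := by
  induction n with
  | zero => simp [convMatrix, cfMatrix]
  | succ n ih =>
    refine ⟨by omega, ?_⟩
    rw [convMatrix_succ_apply_zero, convMatrix_succ_apply_one]
    nlinarith [one_le_floor_completeQuotient_succ hθ n]

theorem convMatrix_denom_add_le {θ : ℝ} (hθ : Irrational θ) (n : ℕ) :
    convMatrix θ (n + 1) 1 0 + convMatrix θ n 1 0 ≤ convMatrix θ (n + 2) 1 0 := by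
  rw [convMatrix_succ_apply_zero θ (n + 1), convMatrix_succ_apply_one]
  nlinarith [one_le_floor_completeQuotient_succ hθ n, convMatrix_denom_mono hθ n]

theorem le_convMatrix_denom {θ : ℝ} (hθ : Irrational θ) (n : ℕ) :
    (n : ℤ) ≤ convMatrix θ (n + 1) 1 0 := by
  induction n with
  | zero => simp [convMatrix, cfMatrix]
  | succ n ih =>
    rcases n with _ | n
    · simpa using (convMatrix_denom_mono hθ 1).2
    · have := convMatrix_denom_add_le hθ (n + 1)
      have := (convMatrix_denom_mono hθ n).2
      push_cast at *
      linarith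

theorem quotientProd_eq {θ : ℝ} (hθ : Irrational θ) (n : ℕ) :
    (convMatrix θ n 1 0 : ℝ) * completeQuotient θ n + convMatrix θ n 1 1 = quotientProd θ n := by
  simpa using convMatrix_mul_completeQuotient hθ n 1

/-- Compare Q_n = q_{n-1} θ_n + q_{n-2} with q_n = q_{n-1} a_n + q_{n-2}, using a_n ≤ θ_n < a_n + 1
≤ 2 a_n. The last inequality needs a_n ≥ 1, whence the index `n + 1` in the second bound. -/
theorem convMatrix_denom_le_quotientProd {θ : ℝ} (hθ : Irrational θ) (n : ℕ) :
    (convMatrix θ (n + 1) 1 0 : ℝ) ≤ quotientProd θ n ∧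
      quotientProd θ (n + 1) ≤ 2 * (convMatrix θ (n + 2) 1 0 : ℝ) := by
  constructor
  · rw [← quotientProd_eq hθ, convMatrix_succ_apply_zero]
    push_cast
    have : (0 : ℝ) ≤ convMatrix θ n 1 0 := by exact_mod_cast (convMatrix_denom_mono hθ n).1
    nlinarith [Int.floor_le (completeQuotient θ n)]
  · rw [← quotientProd_eq hθ, convMatrix_succ_apply_zero θ (n + 1), convMatrix_succ_apply_one]
    push_cast
    have h0 : (0 : ℝ) ≤ convMatrix θ n 1 0 := by exact_mod_cast (convMatrix_denom_mono hθ n).1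
    have h1 : (1 : ℝ) ≤ convMatrix θ (n + 1) 1 0 := by
      exact_mod_cast (convMatrix_denom_mono hθ n).2
    have h2 : (1 : ℝ) ≤ ⌊completeQuotient θ (n + 1)⌋ := by
      exact_mod_cast one_le_floor_completeQuotient_succ hθ n
    nlinarith [Int.lt_floor_add_one (completeQuotient θ (n + 1))]

theorem le_quotientProd {θ : ℝ} (hθ : Irrational θ) (n : ℕ) : (n : ℝ) ≤ quotientProd θ n :=
  le_trans (by exact_mod_cast le_convMatrix_denom hθ n) (convMatrix_denom_le_quotientProd hθ n).1

/-! ### Serret's lemma -/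

theorem floor_eq_and_inv_fract_eq {α κ : ℝ} {a : ℤ} (hκ : 1 < κ) (h : α * κ = a * κ + 1) :
    ⌊α⌋ = a ∧ (Int.fract α)⁻¹ = κ := by
  have h0 : α = a + κ⁻¹ := by
    have : κ ≠ 0 := by linarith
    field_simp
    linarith
  have h1 : κ⁻¹ < 1 := inv_lt_one_of_one_lt₀ hκ
  have h2 : 0 < κ⁻¹ := by positivity
  have hf : ⌊α⌋ = a := by
    rw [Int.floor_eq_iff, h0]
    constructor <;> linarith
  refine ⟨hf, ?_⟩
  rw [← Int.self_sub_floor, hf, h0, add_sub_cancel_left, inv_inv]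

/-- If `α = (a β + b) / (c β + d)` with `β > 1`, determinant `± 1` and `c > d > 0`, then `β` is a
complete quotient of `α`; the conditions at the boundary make an induction on `c` possible. -/
theorem exists_completeQuotient_of_moebius (N : ℕ) : ∀ (a b c d : ℤ) (α β : ℝ), c ≤ N → 1 ≤ c →
    0 ≤ d → d ≤ c → (a * d - b * c = 1 ∨ a * d - b * c = -1) → (d = c → a * d - b * c = 1) →
    (d = 0 → a * d - b * c = -1) → 1 < β → a * β + b = α * (c * β + d) →
    ∃ m, completeQuotient α m = β ∧ convMatrix α m = !![a, b; c, d] := by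
  induction N with
  | zero => intro a b c d α β h1 h2; exact absurd h2 (by push_cast at h1; omega)
  | succ N ih =>
    intro a b c d α β hN hc hd hdc hdet hdc1 hd0 hβ h
    -- If d = 0, the determinant gives b = c = 1, so α = a + 1 / β and a single quotient suffices.
    by_cases hd' : d = 0
    · subst hd'
      have h1 := hd0 rfl
      obtain rfl : c = 1 := by
        have : c ∣ 1 := ⟨b, by linarith⟩
        exact Int.eq_one_of_dvd_one (by omega) this
      obtain rfl : b = 1 := by linarith
      obtain ⟨hf, hi⟩ := floor_eq_and_inv_fract_eq (α := α) (κ := β) (a := a) hβ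
        (by push_cast at h; linarith)
      refine ⟨1, hi, ?_⟩
      simp [convMatrix, completeQuotient, cfMatrix, hf]
    · have hd1 : 1 ≤ d := by omega
      -- One Euclidean step: the matrix is `cfMatrix a₀` times the matrix with rows (c, d), (r, s),
      -- of opposite determinant. For c > 1, r is the remainder of a modulo c, and determinant ±1
      -- forces s into range with the boundary conditions intact. For c = d = 1 the lower left entry
      -- does not drop.
      obtain ⟨a₀, r, s, rfl, rfl, hr, hrc, hs, hsr, hsd, hsr1, hs0⟩ : ∃ a₀ r s : ℤ,
          a = a₀ * c + r ∧ b = a₀ * d + s ∧ 1 ≤ r ∧ (r < c ∨ r = c ∧ c = 1 ∧ s < d) ∧ 0 ≤ s ∧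
            s ≤ r ∧ s ≤ d ∧
            (s = r → c * s - d * r = 1) ∧ (s = 0 → c * s - d * r = -1) := by
        by_cases hc1 : c = 1
        · obtain rfl : d = 1 := by omega
          subst hc1
          have := hdc1 rfl
          exact ⟨b, 1, 0, by linarith, by ring, le_rfl, Or.inr ⟨rfl, rfl, by norm_num⟩, le_rfl,
            by norm_num, by norm_num, by norm_num, by norm_num⟩
        · have hdc' : d < c := by
            rcases hdc.lt_or_eq with h | h
            · exact h
            · exfalso
              have h2 := hdc1 h
              have : c ∣ 1 := ⟨a - b, by rw [← h2, h]; ring⟩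
              exact hc1 (Int.eq_one_of_dvd_one (by omega) this)
          have e1 := Int.emod_add_mul_ediv a c
          have e2 := Int.emod_nonneg a (show c ≠ 0 by omega)
          have e3 := Int.emod_lt_of_pos a (show 0 < c by omega)
          set r := a % c
          set q := a / c
          have hD : r * d - (b - q * d) * c = a * d - b * c := by rw [← e1]; ring
          rw [← hD] at hdet
          set s := b - q * d with hs
          have hr : 1 ≤ r := by
            by_contra hr
            have hr : r = 0 := by omega
            rw [hr] at hdet
            have : c ∣ 1 := by
              rcases hdet with h | h
              · exact ⟨-s, by linarith⟩
              · exact ⟨s, by linarith⟩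
            exact hc1 (Int.eq_one_of_dvd_one (by omega) this)
          have hs0 : 0 ≤ s := by
            by_contra hs0
            have : s ≤ -1 := by omega
            rcases hdet with h | h <;> nlinarith
          have hsr : s ≤ r := by
            by_contra hs0
            have : r + 1 ≤ s := by omega
            rcases hdet with h | h <;> nlinarith
          have hsd : s ≤ d := by
            by_contra hs0
            have : d + 1 ≤ s := by omega
            rcases hdet with h | h <;> nlinarith
          refine ⟨q, r, s, by linarith, by rw [hs]; ring, hr, Or.inl e3, hs0, hsr, hsd, ?_, ?_⟩
          · intro h
            rcases hdet with h' | h' <;> nlinarith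
          · intro h
            rw [h] at hdet ⊢
            rcases hdet with h' | h' <;> nlinarith
      have hdet' : c * s - d * r = 1 ∨ c * s - d * r = -1 := by
        rcases hdet with h | h
        · right; linarith
        · left; linarith
      have hcR : (1 : ℝ) ≤ c := by exact_mod_cast hc
      have hdR : (1 : ℝ) ≤ d := by exact_mod_cast hd1
      have hrR : (1 : ℝ) ≤ r := by exact_mod_cast hr
      have hsR : (0 : ℝ) ≤ s := by exact_mod_cast hs
      have hsdR : (s : ℝ) ≤ d := by exact_mod_cast hsd
      have hpos : 0 < r * β + s := by nlinarith
      have hlt : r * β + s < c * β + d := by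
        rcases hrc with h | ⟨h, -, h'⟩
        · have : (r : ℝ) < c := by exact_mod_cast h
          nlinarith
        · rw [h]
          have : (s : ℝ) < d := by exact_mod_cast h'
          linarith
      obtain ⟨hf, hi⟩ := floor_eq_and_inv_fract_eq (α := α) (κ := (c * β + d) / (r * β + s))
        (a := a₀) ((one_lt_div hpos).2 hlt) (by
          field_simp
          push_cast at h
          linarith)
      rcases hrc with hrc | ⟨rfl, hc1, hsd'⟩
      · obtain ⟨m, hm1, hm2⟩ := ih c d r s ((Int.fract α)⁻¹) β (by push_cast at hN; omega) hr hs hsr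
          hdet' hsr1 hs0 hβ (by rw [hi]; field_simp)
        refine ⟨m + 1, by rw [completeQuotient_succ', hm1], ?_⟩
        rw [convMatrix_succ', hm2, hf]
        ext i j
        fin_cases i <;> fin_cases j <;> simp [cfMatrix, Matrix.mul_apply, Fin.sum_univ_two]
      -- The exceptional case c = d = 1, outside the induction: α = a₀ + 1 / (1 + 1 / β).
      · subst hc1
        obtain rfl : d = 1 := by omega
        obtain rfl : s = 0 := by omega
        obtain ⟨hf', hi'⟩ := floor_eq_and_inv_fract_eq (α := (Int.fract α)⁻¹) (κ := β) (a := 1) hβ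
          (by rw [hi]; field_simp; push_cast; ring)
        refine ⟨2, by rw [completeQuotient_succ', completeQuotient_succ', hi']; rfl, ?_⟩
        rw [convMatrix_succ', hf, convMatrix_succ', hf']
        ext i j
        fin_cases i <;> fin_cases j <;>
          simp [convMatrix, cfMatrix, Matrix.mul_apply, Fin.sum_univ_two]

theorem convMatrix_add (θ : ℝ) (m n : ℕ) :
    convMatrix θ (m + n) = convMatrix θ m * convMatrix (completeQuotient θ m) n := by
  induction n with
  | zero => simp [convMatrix]
  | succ n ih => rw [← add_assoc, convMatrix, ih, convMatrix, Matrix.mul_assoc, completeQuotient_add]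

/-- Cramer's rule for P_n (θ_n, 1) = Q_n (θ, 1). As Q_n ≥ n, the errors of the convergents tend to
0. -/
theorem quotientProd_mul_sub {θ : ℝ} (hθ : Irrational θ) (n : ℕ) :
    quotientProd θ n * (convMatrix θ n 0 0 - θ * convMatrix θ n 1 0) = (-1) ^ n := by
  have h0 := convMatrix_mul_completeQuotient hθ n 0
  have h1 := convMatrix_mul_completeQuotient hθ n 1
  have h2 : ((convMatrix θ n 0 0 * convMatrix θ n 1 1 - convMatrix θ n 0 1 * convMatrix θ n 1 0 : ℤ)
      : ℝ) = (-1) ^ n := by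
    rw [← Matrix.det_fin_two, det_convMatrix]; push_cast; rfl
  push_cast at h2
  simp only [Matrix.cons_val_zero, Matrix.cons_val_one] at h0 h1
  linear_combination h2 + (convMatrix θ n 1 0 : ℝ) * h0 - (convMatrix θ n 0 0 : ℝ) * h1

theorem abs_convMatrix_sub_lt {θ : ℝ} (hθ : Irrational θ) {n : ℕ} {x δ : ℝ} (hδ : 0 < δ)
    (hn : |x| / δ < n) : |x * (convMatrix θ n 0 0 - θ * convMatrix θ n 1 0)| < δ := by
  have h := quotientProd_mul_sub hθ n
  have hp := quotientProd_pos hθ n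
  have h1 : |(convMatrix θ n 0 0 - θ * convMatrix θ n 1 0 : ℝ)| = (quotientProd θ n)⁻¹ := by
    have := congrArg abs h
    rw [abs_mul, abs_pow, abs_neg, abs_one, one_pow, abs_of_pos hp] at this
    exact eq_inv_of_mul_eq_one_right this
  rw [abs_mul, h1, ← div_eq_mul_inv, div_lt_iff₀ hp]
  rw [div_lt_iff₀ hδ] at hn
  nlinarith [le_quotientProd hθ n]

/-! ### The stabilizer of an irrational number -/

/-- The factor `c θ + d` of the matrix with rows `(a, b)` and `(c, d)`. -/
noncomputable def multiplier (M : Matrix.SpecialLinearGroup (Fin 2) ℤ) (θ : ℝ) : ℝ :=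
  (M 1 0 : ℝ) * θ + M 1 1

/-- The stabilizer of the line spanned by `(θ, 1)`. -/
def lineStabilizer (θ : ℝ) : Subgroup (Matrix.SpecialLinearGroup (Fin 2) ℤ) where
  carrier := {M | (M 0 0 : ℝ) * θ + M 0 1 = θ * multiplier M θ}
  one_mem' := by simp [multiplier]
  mul_mem' := by
    intro M N hM hN
    simp only [multiplier, Set.mem_ofPred_eq, Matrix.SpecialLinearGroup.coe_mul, Matrix.mul_apply,
      Fin.sum_univ_two] at hM hN ⊢
    push_cast
    linear_combination ((M 0 0 : ℝ) - θ * M 1 0) * hN +  ((N 1 0 : ℝ) * θ + N 1 1) * hM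
  inv_mem' := by
    intro M hM
    have hdet := M.det_coe
    rw [Matrix.det_fin_two] at hdet
    have hdet : (M 0 0 : ℝ) * M 1 1 - M 0 1 * M 1 0 = 1 := by exact_mod_cast hdet
    simp only [multiplier, Set.mem_ofPred_eq, Matrix.SpecialLinearGroup.coe_inv, Matrix.adjugate_fin_two]
      at hM ⊢
    simp
    linear_combination -hM

theorem mem_lineStabilizer {θ : ℝ} {M : Matrix.SpecialLinearGroup (Fin 2) ℤ} :
    M ∈ lineStabilizer θ ↔ (M 0 0 : ℝ) * θ + M 0 1 = θ * multiplier M θ := Iff.rfl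

theorem det_cast_eq_one (M : Matrix.SpecialLinearGroup (Fin 2) ℤ) :
    (M 0 0 : ℝ) * M 1 1 - M 0 1 * M 1 0 = 1 := by
  have hdet := M.det_coe
  rw [Matrix.det_fin_two] at hdet
  exact_mod_cast hdet

/-- The character of the stabilizer given by the eigenvalue on `(θ, 1)`. -/
noncomputable def multiplierHom (θ : ℝ) : lineStabilizer θ →* ℝ where
  toFun M := multiplier M θ
  map_one' := by simp [multiplier]
  map_mul' := by
    rintro ⟨M, hM⟩ ⟨N, hN⟩
    rw [mem_lineStabilizer] at hM hN
    simp only [multiplier, Matrix.SpecialLinearGroup.coe_mul, Matrix.mul_apply, Subgroup.coe_mul,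
      Fin.sum_univ_two] at hM hN ⊢
    push_cast
    linear_combination (M 1 0 : ℝ) * hN

theorem neg_mem_lineStabilizer {θ : ℝ} {M : Matrix.SpecialLinearGroup (Fin 2) ℤ}
    (hM : M ∈ lineStabilizer θ) : -M ∈ lineStabilizer θ := by
  rw [mem_lineStabilizer] at hM ⊢
  simp [multiplier] at hM ⊢
  linarith

theorem multiplier_neg (θ : ℝ) (M : Matrix.SpecialLinearGroup (Fin 2) ℤ) :
    multiplier (-M) θ = -multiplier M θ := by
  simp [multiplier]; ring

theorem Irrational.intCast_mul_add_eq_zero {θ : ℝ} (hθ : Irrational θ) {a b : ℤ}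
    (h : (a : ℝ) * θ + b = 0) : a = 0 ∧ b = 0 := by
  have ha : a = 0 := by
    by_contra ha
    exact ((hθ.intCast_mul ha).add_intCast b).ne_zero h
  subst ha
  exact ⟨rfl, by simpa using h⟩

theorem multiplier_ne_zero {θ : ℝ} (hθ : Irrational θ)
    (M : Matrix.SpecialLinearGroup (Fin 2) ℤ) : multiplier M θ ≠ 0 := by
  intro h
  obtain ⟨h1, h2⟩ := hθ.intCast_mul_add_eq_zero h
  have := det_cast_eq_one M
  rw [h1, h2] at this
  simp at this

/-- As 1 and θ are independent over ℚ, the multiplier determines the bottom row, and then the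
stabilizer equation determines the top row. -/
theorem eq_of_multiplier_eq {θ : ℝ} (hθ : Irrational θ)
    {M N : Matrix.SpecialLinearGroup (Fin 2) ℤ} (hM : M ∈ lineStabilizer θ)
    (hN : N ∈ lineStabilizer θ) (h : multiplier M θ = multiplier N θ) : M = N := by
  rw [mem_lineStabilizer] at hM hN
  rw [← h] at hN
  have h1 := hθ.intCast_mul_add_eq_zero (a := M 1 0 - N 1 0) (b := M 1 1 - N 1 1)
    (by unfold multiplier at h; push_cast; linarith)
  have h2 := hθ.intCast_mul_add_eq_zero (a := M 0 0 - N 0 0) (b := M 0 1 - N 0 1)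
    (by push_cast; linarith)
  ext i j
  fin_cases i <;> fin_cases j <;> simp <;> linarith

/-- Serret's theorem for the stabilizer. -/
theorem exists_mul_convMatrix_eq {θ : ℝ} (hθ : Irrational θ)
    {M : Matrix.SpecialLinearGroup (Fin 2) ℤ} (hM : M ∈ lineStabilizer θ)
    (hpos : 0 < multiplier M θ) (k : ℕ) :
    ∃ n ≥ k, ∃ m ≥ k, completeQuotient θ m = completeQuotient θ n ∧
      (M : Matrix (Fin 2) (Fin 2) ℤ) * convMatrix θ n = convMatrix θ m := by
  -- One coincidence yields arbitrarily late ones: multiply on the right by the matrix of the next k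
  -- quotients, which are the same on both sides.
  suffices H : ∃ n m, completeQuotient θ m = completeQuotient θ n ∧
      (M : Matrix (Fin 2) (Fin 2) ℤ) * convMatrix θ n = convMatrix θ m by
    obtain ⟨n, m, h1, h2⟩ := H
    refine ⟨n + k, by omega, m + k, by omega, ?_, ?_⟩
    · rw [completeQuotient_add, completeQuotient_add, h1]
    · rw [convMatrix_add, convMatrix_add, ← Matrix.mul_assoc, h2, h1]
  set l := multiplier M θ with hl
  -- The bottom row of M P has entries c p + d q = l q + c (p - θ q). Once the error terms are below
  -- l / 2, q ≥ 1 makes such an entry positive, and an increase of q by at least 1 makes it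
  -- increase.
  obtain ⟨N, hN⟩ := exists_nat_gt (|(M 1 0 : ℝ)| / (l / 2))
  set n := N + 2 with hn
  have hNn : (N : ℝ) ≤ n := by exact_mod_cast (by omega : N ≤ n)
  have b1 := abs_lt.1 (abs_convMatrix_sub_lt hθ (half_pos hpos) (hN.trans_le hNn))
  have b2 := abs_lt.1 (abs_convMatrix_sub_lt hθ (n := n + 1) (half_pos hpos)
    (hN.trans_le (hNn.trans (by push_cast; linarith))))
  have q1 : (1 : ℝ) ≤ convMatrix θ n 1 0 := by
    exact_mod_cast (convMatrix_denom_mono hθ (N + 1)).2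
  have q2 : (convMatrix θ n 1 0 : ℝ) + 1 ≤ convMatrix θ (n + 1) 1 0 := by
    have h1 : convMatrix θ n 1 0 + convMatrix θ (N + 1) 1 0 ≤ convMatrix θ (n + 1) 1 0 :=
      convMatrix_denom_add_le hθ (N + 1)
    have h2 := (convMatrix_denom_mono hθ N).2
    exact_mod_cast (by omega : convMatrix θ n 1 0 + 1 ≤ convMatrix θ (n + 1) 1 0)
  have hD : 0 < M 1 0 * convMatrix θ n 0 0 + M 1 1 * convMatrix θ n 1 0 := by
    have : (0 : ℝ) < M 1 0 * convMatrix θ n 0 0 + M 1 1 * convMatrix θ n 1 0 := by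
      unfold multiplier at hl
      nlinarith
    exact_mod_cast this
  have hCD : M 1 0 * convMatrix θ n 0 0 + M 1 1 * convMatrix θ n 1 0 <
      M 1 0 * convMatrix θ (n + 1) 0 0 + M 1 1 * convMatrix θ (n + 1) 1 0 := by
    have : (M 1 0 : ℝ) * convMatrix θ n 0 0 + M 1 1 * convMatrix θ n 1 0 <
        M 1 0 * convMatrix θ (n + 1) 0 0 + M 1 1 * convMatrix θ (n + 1) 1 0 := by
      unfold multiplier at hl
      nlinarith
    exact_mod_cast this
  have hdet : ((M : Matrix (Fin 2) (Fin 2) ℤ) * convMatrix θ (n + 1)).det = (-1) ^ (n + 1) := by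
    rw [Matrix.det_mul, det_convMatrix, M.det_coe, one_mul]
  set X := (M : Matrix (Fin 2) (Fin 2) ℤ) * convMatrix θ (n + 1) with hX
  have hX10 : X 1 0 = M 1 0 * convMatrix θ (n + 1) 0 0 + M 1 1 * convMatrix θ (n + 1) 1 0 := by
    simp [hX, Matrix.mul_apply, Fin.sum_univ_two]
  have hX11 : X 1 1 = M 1 0 * convMatrix θ n 0 0 + M 1 1 * convMatrix θ n 1 0 := by
    simp [hX, Matrix.mul_apply, Fin.sum_univ_two, convMatrix_succ_apply_one]
  have hact : ∀ i, (X i 0 : ℝ) * completeQuotient θ (n + 1) + X i 1 =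
      quotientProd θ (n + 1) * (l * ![θ, 1] i) := by
    intro i
    have h0 := convMatrix_mul_completeQuotient hθ (n + 1) 0
    have h1 := convMatrix_mul_completeQuotient hθ (n + 1) 1
    rw [mem_lineStabilizer, ← hl] at hM
    simp only [Matrix.cons_val_zero, Matrix.cons_val_one] at h0 h1
    simp only [hX, Matrix.mul_apply, Fin.sum_univ_two]
    push_cast
    fin_cases i
    · simp
      linear_combination (M 0 0 : ℝ) * h0 + (M 0 1 : ℝ) * h1 + quotientProd θ (n + 1) * hM
    · simp [hl, multiplier]
      linear_combination (M 1 0 : ℝ) * h0 + (M 1 1 : ℝ) * h1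
  rw [Matrix.det_fin_two] at hdet
  -- Since 0 < `X 1 1` < `X 1 0`, the boundary hypotheses are vacuous.
  obtain ⟨m, hm1, hm2⟩ := exists_completeQuotient_of_moebius (X 1 0).toNat (X 0 0) (X 0 1) (X 1 0)
    (X 1 1) θ (completeQuotient θ (n + 1)) (by omega) (by omega) (by omega) (by omega)
    (by rw [hdet]; exact neg_one_pow_eq_or ℤ _) (by omega) (by omega)
    (one_lt_completeQuotient_succ hθ n) (by
      have h0 := hact 0
      have h1 := hact 1
      simp only [Matrix.cons_val_zero, Matrix.cons_val_one] at h0 h1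
      rw [h0, h1]; ring)
  refine ⟨n + 1, m, hm1, ?_⟩
  rw [hm2]
  ext i j
  fin_cases i <;> fin_cases j <;> rfl

/-- Apply both sides of the matrix identity to (θ_n, 1) and compare second coordinates. -/
theorem multiplier_mul_quotientProd {θ : ℝ} (hθ : Irrational θ)
    {M : Matrix.SpecialLinearGroup (Fin 2) ℤ} {n m : ℕ} {s : ℤ}
    (hq : completeQuotient θ m = completeQuotient θ n)
    (h : (M : Matrix (Fin 2) (Fin 2) ℤ) * convMatrix θ n = s • convMatrix θ m) :
    multiplier M θ * quotientProd θ n = s * quotientProd θ m := by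
  have h0 := convMatrix_mul_completeQuotient hθ n 0
  have h1 := convMatrix_mul_completeQuotient hθ n 1
  have h2 := convMatrix_mul_completeQuotient hθ m 1
  have e0 := congrFun (congrFun h 1) 0
  have e1 := congrFun (congrFun h 1) 1
  simp only [Matrix.mul_apply, Fin.sum_univ_two, Matrix.smul_apply, smul_eq_mul] at e0 e1
  simp only [Matrix.cons_val_zero, Matrix.cons_val_one, mul_one] at h0 h1 h2
  rw [hq] at h2
  have e0 : (M 1 0 : ℝ) * convMatrix θ n 0 0 + M 1 1 * convMatrix θ n 1 0 =
    s * convMatrix θ m 1 0 := by exact_mod_cast e0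
  have e1 : (M 1 0 : ℝ) * convMatrix θ n 0 1 + M 1 1 * convMatrix θ n 1 1 =
    s * convMatrix θ m 1 1 := by exact_mod_cast e1
  rw [← h2, multiplier]
  linear_combination completeQuotient θ n * e0 + e1 - (M 1 0 : ℝ) * h0 - (M 1 1 : ℝ) * h1

/-! ### Quadratic irrationals -/

theorem exists_int_quadratic {θ : ℝ} (hdeg : (minpoly ℚ θ).natDegree = 2) :
    ∃ A B C : ℤ, A ≠ 0 ∧ (A : ℝ) * θ ^ 2 + B * θ + C = 0 := by
  have h := minpoly.aeval ℚ θ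
  have hm : minpoly ℚ θ ≠ 0 := by
    intro h0
    rw [h0] at hdeg
    simp at hdeg
  rw [Polynomial.aeval_eq_sum_range, hdeg] at h
  simp only [Finset.sum_range_succ, Finset.sum_range_zero, Rat.smul_def] at h
  have h2 : (minpoly ℚ θ).coeff 2 ≠ 0 := by
    rw [← hdeg]; exact Polynomial.leadingCoeff_ne_zero.2 hm
  set x := (minpoly ℚ θ).coeff 2
  set y := (minpoly ℚ θ).coeff 1
  set z := (minpoly ℚ θ).coeff 0
  refine ⟨x.num * y.den * z.den, y.num * x.den * z.den, z.num * x.den * y.den, ?_, ?_⟩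
  · simp [h2]
  · rw [Rat.cast_def x, Rat.cast_def y, Rat.cast_def z] at h
    have hx : (x.den : ℝ) ≠ 0 := by exact_mod_cast x.den_nz
    have hy : (y.den : ℝ) ≠ 0 := by exact_mod_cast y.den_nz
    have hz : (z.den : ℝ) ≠ 0 := by exact_mod_cast z.den_nz
    field_simp at h
    push_cast
    linear_combination h

/-- With D = B² - 4AC, the traceless matrix J with rows (-B, -2C), (2A, B) preserves the line and
has J² = D. So x + y J has determinant x² - D y², and a Pell solution with y ≠ 0 does the job. D is
not a square because (2Aθ + B)² = D with 2Aθ + B irrational. -/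
theorem exists_mem_lineStabilizer {θ : ℝ} (hθ : Irrational θ)
    (hdeg : (minpoly ℚ θ).natDegree = 2) :
    ∃ M ∈ lineStabilizer θ, M 1 0 ≠ 0 := by
  obtain ⟨A, B, C, hA, h⟩ := exists_int_quadratic hdeg
  have hD : ((B ^ 2 - 4 * A * C : ℤ) : ℝ) = (2 * A * θ + B) ^ 2 := by
    push_cast; linear_combination (-4 * A : ℝ) * h
  have hirr : Irrational (2 * A * θ + B) := by
    have : Irrational (((2 * A : ℤ) : ℝ) * θ + B) :=
      (hθ.intCast_mul (by simpa using hA)).add_intCast B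
    simpa using this
  have hpos : 0 < B ^ 2 - 4 * A * C := by
    have : (0 : ℝ) < (2 * A * θ + B) ^ 2 := by
      have := hirr.ne_zero
      positivity
    rw [← hD] at this
    exact_mod_cast this
  have hsq : ¬ IsSquare (B ^ 2 - 4 * A * C) := by
    rintro ⟨r, hr⟩
    rw [hr] at hD
    push_cast at hD
    rcases sq_eq_sq_iff_eq_or_eq_neg.1 ((sq (r : ℝ)).trans hD) with h | h
    · exact (Int.not_irrational r) (h ▸ hirr)
    · exact (Int.not_irrational (-r)) (by push_cast; rw [h, neg_neg]; exact hirr)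
  obtain ⟨x, y, hxy, hy⟩ := Pell.exists_of_not_isSquare hpos hsq
  refine ⟨⟨!![x - B * y, -2 * C * y; 2 * A * y, x + B * y], ?_⟩, ?_, ?_⟩
  · rw [Matrix.det_fin_two_of]
    linarith
  · change ((x - B * y : ℤ) : ℝ) * θ + ((-2 * C * y : ℤ) : ℝ) =
      θ * (((2 * A * y : ℤ) : ℝ) * θ + ((x + B * y : ℤ) : ℝ))
    push_cast
    linear_combination (-2 * y : ℝ) * h
  · simp [hA, hy]

/-- Lagrange's theorem: the complete quotients of a quadratic irrational repeat. -/
theorem exists_completeQuotient_eq {θ : ℝ} (hθ : Irrational θ)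
    (hdeg : (minpoly ℚ θ).natDegree = 2) :
    ∃ n l : ℕ, 0 < l ∧ completeQuotient θ (n + l) = completeQuotient θ n := by
  obtain ⟨M, hM, hM0⟩ : ∃ M ∈ lineStabilizer θ, M 1 0 ≠ 0 ∧ 0 < multiplier M θ := by
    obtain ⟨M, hM, hM0⟩ := exists_mem_lineStabilizer hθ hdeg
    rcases (multiplier_ne_zero hθ M).lt_or_gt with h | h
    · exact ⟨-M, neg_mem_lineStabilizer hM, by simpa using hM0, by rw [multiplier_neg]; linarith⟩
    · exact ⟨M, hM, hM0, h⟩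
  obtain ⟨n, -, m, -, hq, hmul⟩ := exists_mul_convMatrix_eq hθ hM hM0.2 0
  -- If n = m, the multiplier would be 1, and irrationality would give c = 0.
  have hne : n ≠ m := by
    rintro rfl
    have h1 := multiplier_mul_quotientProd hθ (s := 1) hq (by simpa using hmul)
    have h2 := quotientProd_pos hθ n
    have h3 : multiplier M θ = 1 := by
      rw [Int.cast_one] at h1
      exact mul_right_cancel₀ h2.ne' h1
    exact hM0.1 (hθ.intCast_mul_add_eq_zero (b := M 1 1 - 1)
      (by rw [multiplier] at h3; push_cast; linarith)).1
  rcases hne.lt_or_gt with h | h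
  · exact ⟨n, m - n, by omega, by rw [Nat.add_sub_cancel' h.le, hq]⟩
  · exact ⟨m, n - m, by omega, by rw [Nat.add_sub_cancel' h.le, hq]⟩

/-! ### The minimal period and the multipliers it generates. -/

theorem completeQuotient_add_mul {θ : ℝ} {k l : ℕ}
    (h : ∀ n ≥ k, completeQuotient θ (n + l) = completeQuotient θ n) (i : ℕ) {n : ℕ} (hn : k ≤ n) :
    completeQuotient θ (n + l * i) = completeQuotient θ n := by
  induction i with
  | zero => rfl
  | succ i ih => rw [Nat.mul_succ, ← add_assoc, h _ (by omega), ih]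

/-- The minimal period divides every period. -/
theorem exists_minimal_period {θ : ℝ} (hθ : Irrational θ)
    (hdeg : (minpoly ℚ θ).natDegree = 2) :
    ∃ p k : ℕ, IsLeast {l : ℕ | IsEventualCFPeriod θ l} p ∧
      (∀ n ≥ k, completeQuotient θ (n + p) = completeQuotient θ n) ∧
      ∀ n l, completeQuotient θ (n + l) = completeQuotient θ n → p ∣ l := by
  have of_eq : ∀ n l, completeQuotient θ (n + l) = completeQuotient θ n → ∀ m ≥ n,
      completeQuotient θ (m + l) = completeQuotient θ m := by
    intro n l h m hm
    obtain ⟨t, rfl⟩ := Nat.exists_eq_add_of_le hm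
    rw [add_right_comm, completeQuotient_add, h, ← completeQuotient_add]
  have hex : ∃ l, IsEventualCFPeriod θ l := by
    obtain ⟨n, l, hl, h⟩ := exists_completeQuotient_eq hθ hdeg
    exact ⟨l, (isEventualCFPeriod_iff hθ l).2 ⟨hl, n, of_eq n l h⟩⟩
  classical
  set p := Nat.find hex
  have hp := Nat.find_spec hex
  obtain ⟨hp0, k, hk⟩ := (isEventualCFPeriod_iff hθ p).1 hp
  refine ⟨p, k, ⟨hp, fun l hl => Nat.find_min' hex hl⟩, hk, fun n l hl => ?_⟩
  by_contra hdvd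
  refine Nat.find_min hex (m := l % p) (Nat.mod_lt _ hp0) ((isEventualCFPeriod_iff hθ _).2
    ⟨Nat.pos_of_ne_zero fun h => hdvd (Nat.dvd_of_mod_eq_zero h), k + n, fun m hm => ?_⟩)
  have h1 := of_eq n l hl m (by omega)
  rw [← Nat.mod_add_div l p, ← add_assoc, completeQuotient_add_mul hk _ (by omega)] at h1
  exact h1

/-- From index k on, each period multiplies Q_n by the same factor, the product of the complete
quotients over one period. -/
theorem quotientProd_add {θ : ℝ} {k l : ℕ} (hθ : Irrational θ)
    (h : ∀ n ≥ k, completeQuotient θ (n + l) = completeQuotient θ n) {n : ℕ} (hn : k ≤ n) :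
    quotientProd θ (n + l) = quotientProd θ (k + l) / quotientProd θ k * quotientProd θ n := by
  induction n, hn using Nat.le_induction with
  | base => rw [div_mul_cancel₀ _ (quotientProd_pos hθ k).ne']
  | succ n hn ih =>
    rw [add_right_comm, quotientProd_succ, ih, quotientProd_succ, add_right_comm, h _ (by omega),
      mul_assoc]

theorem quotientProd_add_mul {θ : ℝ} {k l : ℕ} (hθ : Irrational θ)
    (h : ∀ n ≥ k, completeQuotient θ (n + l) = completeQuotient θ n) (i : ℕ) {n : ℕ} (hn : k ≤ n) :
    quotientProd θ (n + l * i) =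
      (quotientProd θ (k + l) / quotientProd θ k) ^ i * quotientProd θ n := by
  induction i with
  | zero => simp
  | succ i ih =>
    rw [Nat.mul_succ, ← add_assoc, quotientProd_add hθ h (by omega), ih, pow_succ']
    ring

/-- The multipliers of the stabilizer are the powers of that of the period, up to sign. -/
theorem exists_multiplier_eq_zpow {θ : ℝ} (hθ : Irrational θ) {k l : ℕ}
    (h : ∀ n ≥ k, completeQuotient θ (n + l) = completeQuotient θ n)
    (hdvd : ∀ n i, Even i → completeQuotient θ (n + i) = completeQuotient θ n → l ∣ i)
    {M : Matrix.SpecialLinearGroup (Fin 2) ℤ} (hM : M ∈ lineStabilizer θ) :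
    ∃ j : ℤ, |multiplier M θ| = (quotientProd θ (k + l) / quotientProd θ k) ^ j := by
  wlog hpos : 0 < multiplier M θ generalizing M
  · have := this (neg_mem_lineStabilizer hM) (by
      rw [multiplier_neg]
      have := multiplier_ne_zero hθ M
      have := lt_of_le_of_ne (not_lt.1 hpos) this
      linarith)
    rwa [multiplier_neg, abs_neg] at this
  rw [abs_of_pos hpos]
  obtain ⟨n, hn, m, hm, hq, hmul⟩ := exists_mul_convMatrix_eq hθ hM hpos k
  have h1 := multiplier_mul_quotientProd hθ (s := 1) hq (by simpa using hmul)
  rw [Int.cast_one, one_mul] at h1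
  -- Since det M = 1, n and m have the same parity. This is why only even period lengths count.
  have hdet := congrArg Matrix.det hmul
  rw [Matrix.det_mul, det_convMatrix, det_convMatrix, M.det_coe, one_mul] at hdet
  have hpar : Even n ↔ Even m := by
    rw [← neg_one_pow_eq_one_iff_even (R := ℤ) (by norm_num), hdet,
      neg_one_pow_eq_one_iff_even (by norm_num)]
  have hn0 := quotientProd_pos hθ n
  have hm0 := quotientProd_pos hθ m
  rcases le_total n m with hnm | hnm
  · obtain ⟨t, rfl⟩ := Nat.exists_eq_add_of_le hnm
    obtain ⟨i, rfl⟩ := hdvd n t (by rw [Nat.even_add] at hpar; tauto) hq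
    refine ⟨i, ?_⟩
    rw [quotientProd_add_mul hθ h i hn] at h1
    rw [zpow_natCast]
    exact mul_right_cancel₀ hn0.ne' h1
  · obtain ⟨t, rfl⟩ := Nat.exists_eq_add_of_le hnm
    obtain ⟨i, rfl⟩ := hdvd m t (by rw [Nat.even_add] at hpar; tauto) hq.symm
    refine ⟨-i, ?_⟩
    rw [quotientProd_add_mul hθ h i hm] at h1
    rw [_root_.zpow_neg, zpow_natCast]
    refine eq_inv_of_mul_eq_one_left (mul_right_cancel₀ hm0.ne' ?_)
    rw [one_mul, mul_assoc, h1]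

/-- A matrix of the stabilizer associated to an even period. -/
theorem exists_multiplier_eq {θ : ℝ} (hθ : Irrational θ) {k l : ℕ} (hl : Even l)
    (h : completeQuotient θ (k + l) = completeQuotient θ k) :
    ∃ M ∈ lineStabilizer θ, |multiplier M θ| = quotientProd θ (k + l) / quotientProd θ k := by
  -- The adjugate of P_k is (-1)^k P_k⁻¹, so M = ±P_{k+l} P_k⁻¹; hence the absolute value in the
  -- conclusion.
  have hdet : (convMatrix θ (k + l) * (convMatrix θ k).adjugate).det = 1 := by
    rw [Matrix.det_mul, Matrix.det_adjugate, det_convMatrix, det_convMatrix, Fintype.card_fin,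
      pow_one, pow_add, hl.neg_one_pow, mul_one, ← pow_add]
    exact (Even.add_self k).neg_one_pow
  set M : Matrix.SpecialLinearGroup (Fin 2) ℤ := ⟨_, hdet⟩ with hMdef
  have hmul : (M : Matrix (Fin 2) (Fin 2) ℤ) * convMatrix θ k =
      (-1 : ℤ) ^ k • convMatrix θ (k + l) := by
    rw [hMdef]
    change convMatrix θ (k + l) * (convMatrix θ k).adjugate * convMatrix θ k = _
    rw [Matrix.mul_assoc, Matrix.adjugate_mul, det_convMatrix, Matrix.mul_smul, Matrix.mul_one]
  have hM : M ∈ lineStabilizer θ := by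
    have h0 := convMatrix_mul_completeQuotient hθ k 0
    have h1 := convMatrix_mul_completeQuotient hθ k 1
    have g0 := convMatrix_mul_completeQuotient hθ (k + l) 0
    have g1 := convMatrix_mul_completeQuotient hθ (k + l) 1
    have e : ∀ i j, (M i 0 : ℝ) * convMatrix θ k 0 j + M i 1 * convMatrix θ k 1 j =
        (-1) ^ k * convMatrix θ (k + l) i j := by
      intro i j
      have := congrFun (congrFun hmul i) j
      simp only [Matrix.mul_apply, Fin.sum_univ_two, Matrix.smul_apply, smul_eq_mul] at this
      exact_mod_cast this
    have e00 := e 0 0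
    have e01 := e 0 1
    have e10 := e 1 0
    have e11 := e 1 1
    simp only [Matrix.cons_val_zero, Matrix.cons_val_one, mul_one] at h0 h1 g0 g1
    rw [h] at g0 g1
    rw [mem_lineStabilizer, multiplier]
    refine mul_left_cancel₀ (quotientProd_pos hθ k).ne' ?_
    linear_combination completeQuotient θ k * (e00 - θ * e10) + e01 - θ * e11 -
      (M 0 0 - θ * M 1 0) * h0 - (M 0 1 - θ * M 1 1) * h1 + (-1) ^ k * (g0 - θ * g1)
  refine ⟨M, hM, ?_⟩
  have h1 := multiplier_mul_quotientProd hθ h hmul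
  have hk := quotientProd_pos hθ k
  have h2 := congrArg abs h1
  push_cast at h2
  rw [abs_mul, abs_mul, abs_pow, abs_neg, abs_one, one_pow, one_mul,
    abs_of_pos (quotientProd_pos hθ (k + l)), abs_of_pos hk] at h2
  rw [eq_div_iff hk.ne', h2]

theorem quotientProd_lt {θ : ℝ} (hθ : Irrational θ) (k : ℕ) {l : ℕ} (hl : 0 < l) :
    quotientProd θ k < quotientProd θ (k + l) := by
  induction l, hl using Nat.le_induction with
  | base =>
    rw [Nat.succ_eq_add_one, Nat.zero_add, quotientProd_succ]
    exact lt_mul_of_one_lt_right (quotientProd_pos hθ k) (one_lt_completeQuotient_succ hθ k)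
  | succ l hl ih =>
    rw [← add_assoc, quotientProd_succ]
    exact ih.trans
      (lt_mul_of_one_lt_right (quotientProd_pos hθ _) (one_lt_completeQuotient_succ hθ _))

/-! ### The Lévy constant -/

theorem exists_bound_of_eventually_periodic {g : ℕ → ℝ} {k l : ℕ} (hl : 0 < l)
    (h : ∀ n ≥ k, g (n + l) = g n) : ∃ B, ∀ n, |g n| ≤ B := by
  refine ⟨∑ i ∈ Finset.range (k + l), |g i|, fun n => ?_⟩
  induction n using Nat.strong_induction_on with
  | _ n ih =>
    by_cases hn : n < k + l
    · exact Finset.single_le_sum (f := fun i => |g i|) (fun i _ => abs_nonneg _)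
        (Finset.mem_range.2 hn)
    · have := h (n - l) (by omega)
      rw [Nat.sub_add_cancel (by omega)] at this
      rw [this]
      exact ih _ (by omega)

/-- The sequence log Q_n - n (log ε) / l is eventually periodic, hence bounded, and log q_n differs
from log Q_n by at most log 2. Dividing by n gives the limit. -/
theorem hasLevyConstant {θ : ℝ} (hθ : Irrational θ) {k l : ℕ} (hl : 0 < l)
    (h : ∀ n ≥ k, completeQuotient θ (n + l) = completeQuotient θ n) :
    HasLevyConstant θ (Real.log (quotientProd θ (k + l) / quotientProd θ k) / l) := by
  set L := Real.log (quotientProd θ (k + l) / quotientProd θ k) with hL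
  have hl' : (l : ℝ) ≠ 0 := by positivity
  have hpos := quotientProd_pos hθ
  obtain ⟨B, hB⟩ := exists_bound_of_eventually_periodic (k := k) hl
    (g := fun n => Real.log (quotientProd θ n) - n * (L / l)) (by
      intro n hn
      rw [quotientProd_add hθ h hn, Real.log_mul (div_pos (hpos _) (hpos _)).ne' (hpos n).ne', ← hL]
      push_cast
      field_simp
      ring)
  have hbound : ∀ n : ℕ, 1 ≤ n →
      |1 / (n : ℝ) * Real.log ((GenContFract.of θ).dens.get n) - L / l| ≤
        (B + Real.log 2) / n := by
    intro n hn
    have hd : (GenContFract.of θ).dens.get n = convMatrix θ (n + 1) 1 0 := dens_eq_convMatrix hθ n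
    have h1 := (convMatrix_denom_le_quotientProd hθ n).1
    obtain ⟨m, rfl⟩ := Nat.exists_eq_add_of_le' hn
    have h2 := (convMatrix_denom_le_quotientProd hθ m).2
    have h3 : (0 : ℝ) < convMatrix θ (m + 1 + 1) 1 0 := by
      exact_mod_cast (convMatrix_denom_mono hθ (m + 1)).2
    have l1 := Real.log_le_log h3 h1
    have l2 := Real.log_le_log (hpos _) h2
    rw [Real.log_mul (by norm_num) h3.ne'] at l2
    have hn0 : (0 : ℝ) < (m + 1 : ℕ) := by positivity
    rw [hd]
    have hb := abs_le.1 (hB (m + 1))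
    have l3 : 0 ≤ Real.log 2 := Real.log_nonneg (by norm_num)
    rw [show 1 / ((m + 1 : ℕ) : ℝ) * Real.log (convMatrix θ (m + 1 + 1) 1 0) - L / l =
      (Real.log (convMatrix θ (m + 1 + 1) 1 0) - (m + 1 : ℕ) * (L / l)) / (m + 1 : ℕ) by
        field_simp, abs_div, abs_of_pos hn0]
    refine div_le_div_of_nonneg_right ?_ hn0.le
    rw [abs_le]
    constructor <;> linarith [hb.1, hb.2]
  rw [HasLevyConstant, tendsto_iff_dist_tendsto_zero]
  refine squeeze_zero' (Eventually.of_forall fun _ => dist_nonneg) ?_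
    (tendsto_const_div_atTop_nhds_zero_nat (B + Real.log 2))
  filter_upwards [eventually_ge_atTop 1] with n hn
  exact hbound n hn

/-! ### The entropy of a toral automorphism -/

theorem iterate_toralMap_toTorus2 (M : Matrix (Fin 2) (Fin 2) ℤ) (k : ℕ) (v : Fin 2 → ℝ) :
    (toralMap M)^[k] (toTorus2 v) =
      toTorus2 ((fun w => M.map (Int.cast : ℤ → ℝ) *ᵥ w)^[k] v) := by
  have h : Function.Semiconj toTorus2 (fun w => M.map (Int.cast : ℤ → ℝ) *ᵥ w) (toralMap M) :=
    fun w => (toralMap_toTorus2 M w).symm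
  exact ((h.iterate_right k) v).symm

theorem iterate_mulVec_sub (A : Matrix (Fin 2) (Fin 2) ℝ) (k : ℕ) (v w : Fin 2 → ℝ) :
    (fun w => A *ᵥ w)^[k] v - (fun w => A *ᵥ w)^[k] w = (fun w => A *ᵥ w)^[k] (v - w) := by
  induction k generalizing v w with
  | zero => rfl
  | succ k ih => simp only [Function.iterate_succ_apply, ih, Matrix.mulVec_sub]

theorem iterate_mulVec_functional {A : Matrix (Fin 2) (Fin 2) ℝ} {u : (Fin 2 → ℝ) → ℝ} {ν : ℝ}
    (hu : ∀ v, u (A *ᵥ v) = ν * u v) (k : ℕ) (v : Fin 2 → ℝ) :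
    u ((fun w => A *ᵥ w)^[k] v) = ν ^ k * u v := by
  induction k generalizing v with
  | zero => simp
  | succ k ih => rw [Function.iterate_succ_apply, ih, hu, pow_succ, mul_assoc]

theorem iterate_mulVec_smul {A : Matrix (Fin 2) (Fin 2) ℝ} {e : Fin 2 → ℝ} {ν : ℝ}
    (he : A *ᵥ e = ν • e) (k : ℕ) (t : ℝ) :
    (fun w => A *ᵥ w)^[k] (t • e) = (t * ν ^ k) • e := by
  induction k generalizing t with
  | zero => simp
  | succ k ih =>
    rw [Function.iterate_succ_apply, Matrix.mulVec_smul, he, smul_smul, ih, pow_succ']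
    congr 1
    ring

theorem dist_coe_unitAddCircle_le (x y : ℝ) : dist (x : UnitAddCircle) y ≤ |x - y| := by
  rw [dist_eq_norm, ← AddCircle.coe_sub, UnitAddCircle.norm_eq]
  simpa using round_le (x - y) 0

theorem dist_coe_unitAddCircle_eq {x y : ℝ} (h : |x - y| ≤ 1 / 2) :
    dist (x : UnitAddCircle) y = |x - y| := by
  rw [dist_eq_norm, ← AddCircle.coe_sub]
  exact (AddCircle.norm_coe_eq_abs_iff 1 one_ne_zero).2 (by simpa using h)

theorem exists_toTorus2_eq (x : Torus2) :
    ∃ v : Fin 2 → ℝ, toTorus2 v = x ∧ ∀ i, |v i| ≤ 1 := by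
  choose b hb hbx using fun i => AddCircle.eq_coe_Ico (x i)
  exact ⟨b, funext hbx, fun i => abs_le.2 ⟨by linarith [(hb i).1], (hb i).2.le⟩⟩

open Dynamics in
-- The functionals u and s serve as coordinates in which M is diagonal. A grid of mesh δ / |ν|^n in
-- u and δ in s follows every point of the box for n iterates: the u-error grows to at most δ and
-- the s-error does not grow. Such a grid has O(|ν|^n) points.
theorem coverMincard_toralMap_le {M : Matrix (Fin 2) (Fin 2) ℤ} {ν μ : ℝ} (hν : 1 < |ν|)
    (hμ : |μ| ≤ 1) {u s : (Fin 2 → ℝ) → ℝ} (hu : ∀ v, u (M.map (Int.cast : ℤ → ℝ) *ᵥ v) = ν * u v)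
    (hs : ∀ v, s (M.map (Int.cast : ℤ → ℝ) *ᵥ v) = μ * s v)
    (hu_sub : ∀ v w, u (v - w) = u v - u w) (hs_sub : ∀ v w, s (v - w) = s v - s w)
    (hsurj : ∀ y z, ∃ v, u v = y ∧ s v = z) {K B : ℝ} (hK : 0 < K) (hB : 0 < B)
    (hbd : ∀ v i, |v i| ≤ K * (|u v| + |s v|)) (hu_bd : ∀ v, (∀ i, |v i| ≤ 1) → |u v| ≤ B)
    (hs_bd : ∀ v, (∀ i, |v i| ≤ 1) → |s v| ≤ B) {ρ : ℝ} (hρ : 0 < ρ) :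
    ∃ C : ℝ, 0 ≤ C ∧ ∀ n : ℕ,
      (coverMincard (toralMap M) Set.univ {p : Torus2 × Torus2 | dist p.1 p.2 < ρ} n : ENNReal) ≤
        ENNReal.ofReal C * ENNReal.ofReal |ν| ^ n := by
  choose z hzu hzs using hsurj
  -- Chosen so that the final error K (δ + δ) is ρ / 2.
  set δ := ρ / (4 * K) with hδ
  have hδ0 : 0 < δ := by positivity
  have hBδ : 0 ≤ B / δ := by positivity
  refine ⟨(2 * (B / δ + 1) + 1) * (2 * (B / δ + 1) + 1), by positivity, fun n => ?_⟩
  have hνn : 1 ≤ |ν| ^ n := one_le_pow₀ hν.le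
  have hνn0 : 0 < |ν| ^ n := by positivity
  set Nu := ⌈B * |ν| ^ n / δ⌉₊
  set Ns := ⌈B / δ⌉₊
  have hNu : (Nu : ℝ) ≤ B / δ * |ν| ^ n + 1 := by
    have := Nat.ceil_lt_add_one (a := B * |ν| ^ n / δ) (by positivity)
    rw [div_mul_eq_mul_div]
    exact this.le
  have hNs : (Ns : ℝ) ≤ B / δ + 1 := (Nat.ceil_lt_add_one hBδ).le
  classical
  set S : Finset Torus2 := (Finset.Icc (-(Nu : ℤ)) Nu ×ˢ Finset.Icc (-(Ns : ℤ)) Ns).image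
    (fun ij => toTorus2 (z (ij.1 * δ / |ν| ^ n) (ij.2 * δ))) with hS
  have floor_mem : ∀ (t : ℝ) (N : ℕ), |t| ≤ N → ⌊t⌋ ∈ Finset.Icc (-(N : ℤ)) N := by
    intro t N ht
    rw [abs_le] at ht
    rw [Finset.mem_Icc, Int.le_floor]
    refine ⟨by push_cast; exact ht.1, ?_⟩
    have := (Int.floor_le t).trans ht.2
    exact_mod_cast this
  have hcover : IsDynCoverOf (toralMap M) Set.univ
      {p : Torus2 × Torus2 | dist p.1 p.2 < ρ} n (S : Set Torus2) := by
    intro x _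
    obtain ⟨v, rfl, hv⟩ := exists_toTorus2_eq x
    set i := ⌊u v * |ν| ^ n / δ⌋ with hi
    set j := ⌊s v / δ⌋ with hj
    refine ⟨_, Finset.mem_coe.2 (Finset.mem_image_of_mem _ (a := (i, j)) ?_), ?_⟩
    · rw [Finset.mem_product]
      refine ⟨floor_mem _ _ ?_, floor_mem _ _ ?_⟩
      · rw [abs_div, abs_mul, abs_of_pos hδ0, abs_of_pos hνn0]
        refine le_trans ?_ (Nat.le_ceil _)
        gcongr
        exact hu_bd v hv
      · rw [abs_div, abs_of_pos hδ0]
        refine le_trans ?_ (Nat.le_ceil _)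
        gcongr
        exact hs_bd v hv
    · rw [mem_dynEntourage]
      intro k hk
      rw [iterate_toralMap_toTorus2, iterate_toralMap_toTorus2]
      change dist _ _ < ρ
      rw [dist_pi_lt_iff hρ]
      intro m
      refine (dist_coe_unitAddCircle_le _ _).trans_lt ?_
      rw [← Pi.sub_apply, iterate_mulVec_sub]
      refine (hbd _ _).trans_lt ?_
      rw [iterate_mulVec_functional hu, iterate_mulVec_functional hs, hu_sub, hs_sub, hzu, hzs,
        abs_mul, abs_mul, abs_pow, abs_pow]
      have h1 : |u v - i * δ / |ν| ^ n| ≤ δ / |ν| ^ n := by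
        have h := Int.self_sub_floor (u v * |ν| ^ n / δ)
        rw [← hi] at h
        rw [show u v - i * δ / |ν| ^ n = (u v * |ν| ^ n / δ - i) * (δ / |ν| ^ n) by
          field_simp, h, abs_mul, Int.abs_fract, abs_of_pos (div_pos hδ0 hνn0)]
        exact mul_le_of_le_one_left (by positivity) (Int.fract_lt_one _).le
      have h2 : |s v - j * δ| ≤ δ := by
        have h := Int.self_sub_floor (s v / δ)
        rw [← hj] at h
        rw [show s v - j * δ = (s v / δ - j) * δ by field_simp, h, abs_mul, Int.abs_fract,
          abs_of_pos hδ0]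
        exact mul_le_of_le_one_left (by positivity) (Int.fract_lt_one _).le
      have h3 : |ν| ^ k * |u v - i * δ / |ν| ^ n| ≤ δ := by
        calc _ ≤ |ν| ^ n * (δ / |ν| ^ n) := by
              gcongr
              exact hν.le
          _ = δ := by field_simp
      have h4 : |μ| ^ k * |s v - j * δ| ≤ δ :=
        (mul_le_of_le_one_left (abs_nonneg _) (pow_le_one₀ (abs_nonneg _) hμ)).trans h2
      calc _ ≤ K * (δ + δ) := by gcongr
        _ = ρ / 2 := by rw [hδ]; field_simp; ring
        _ < ρ := half_lt_self hρ
  have hcard : (S.card : ℝ) ≤ (2 * Nu + 1) * (2 * Ns + 1) := by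
    have h := Finset.card_image_le (s := Finset.Icc (-(Nu : ℤ)) Nu ×ˢ Finset.Icc (-(Ns : ℤ)) Ns)
      (f := fun ij => toTorus2 (z (ij.1 * δ / |ν| ^ n) (ij.2 * δ)))
    rw [Finset.card_product, Int.card_Icc, Int.card_Icc] at h
    have e : ∀ N : ℕ, ((N : ℤ) + 1 - -(N : ℤ)).toNat = 2 * N + 1 := fun N => by omega
    rw [e, e] at h
    exact_mod_cast h
  have hfin : (S.card : ℝ) ≤ (2 * (B / δ + 1) + 1) * (2 * (B / δ + 1) + 1) * |ν| ^ n := by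
    have h1 : 2 * (Nu : ℝ) + 1 ≤ (2 * (B / δ + 1) + 1) * |ν| ^ n := by nlinarith
    calc (S.card : ℝ) ≤ _ := hcard
      _ ≤ ((2 * (B / δ + 1) + 1) * |ν| ^ n) * (2 * (B / δ + 1) + 1) := by gcongr
      _ = _ := by ring
  calc (coverMincard (toralMap M) Set.univ {p : Torus2 × Torus2 | dist p.1 p.2 < ρ} n : ENNReal)
      ≤ ((S.card : ℕ∞) : ENNReal) := ENat.toENNReal_mono hcover.coverMincard_le_card
    _ = ENNReal.ofReal S.card := by simp
    _ ≤ _ := by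
      rw [← ENNReal.ofReal_pow (abs_nonneg _), ← ENNReal.ofReal_mul (by positivity)]
      exact ENNReal.ofReal_le_ofReal hfin

open Dynamics in
-- Points spaced r / |ν|^n apart along the expanding eigenvector are at least r apart in the plane
-- at time n. The only danger is wrapping around the torus. As long as the displacement is below r,
-- the next one is at most |ν| r ≤ 1/2, where torus and plane distances agree; so two orbits cannot
-- stay r-close up to time n. Nets require disjoint balls, hence the radius r / 2, and `n + 1`
-- covers the times 0, …, n.
theorem le_netMaxcard_toralMap {M : Matrix (Fin 2) (Fin 2) ℤ} {ν : ℝ} (hν : 1 < |ν|)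
    {e : Fin 2 → ℝ} (he : M.map (Int.cast : ℤ → ℝ) *ᵥ e = ν • e) {i₀ : Fin 2} (he0 : e i₀ = 1)
    {r : ℝ} (hr : 0 < r) (hrν : |ν| * r ≤ 1 / 2) (n : ℕ) :
    ENNReal.ofReal |ν| ^ n ≤
      (netMaxcard (toralMap M) Set.univ {p : Torus2 × Torus2 | dist p.1 p.2 < r / 2} (n + 1) :
        ENNReal) := by
  have hν0 : 0 < |ν| := by linarith
  have hνn : 0 < |ν| ^ n := by positivity
  set N := ⌊|ν| ^ n⌋₊ + 1 with hN
  set η := r / |ν| ^ n with hη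
  set x : ℕ → Torus2 := fun i => toTorus2 ((i * η) • e) with hx
  have hr2 : r ≤ 1 / 2 := by nlinarith
  have sep : ∀ i j, i < N → j < N → i ≠ j →
      ¬ ∀ k < n + 1, dist ((toralMap M)^[k] (x i)) ((toralMap M)^[k] (x j)) < r := by
    intro i j hi hj hij h
    have hij1 : (1 : ℝ) ≤ |(i : ℝ) - j| := by
      have : (1 : ℤ) ≤ |(i : ℤ) - j| := Int.one_le_abs (by omega)
      exact_mod_cast this
    have hijn : |(i : ℝ) - j| ≤ |ν| ^ n := by
      have h1 : |(i : ℤ) - j| ≤ ⌊|ν| ^ n⌋₊ := by rw [abs_le]; omega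
      have h2 : |(i : ℝ) - j| ≤ ⌊|ν| ^ n⌋₊ := by exact_mod_cast h1
      exact h2.trans (Nat.floor_le hνn.le)
    have hη0 : 0 < η := by positivity
    have key : ∀ k < n + 1, |(i : ℝ) - j| * η * |ν| ^ k ≤ 1 / 2 →
        |(i : ℝ) - j| * η * |ν| ^ k < r := by
      intro k hk hle
      have hd := h k hk
      rw [dist_pi_lt_iff hr] at hd
      have hd := hd i₀
      rw [hx, iterate_toralMap_toTorus2, iterate_toralMap_toTorus2, iterate_mulVec_smul he,
        iterate_mulVec_smul he] at hd
      have e1 : |(((i : ℝ) * η * ν ^ k) • e) i₀ - (((j : ℝ) * η * ν ^ k) • e) i₀| =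
          |(i : ℝ) - j| * η * |ν| ^ k := by
        rw [Pi.smul_apply, Pi.smul_apply, he0, smul_eq_mul, smul_eq_mul, mul_one, mul_one,
          ← abs_pow, ← abs_of_pos hη0, ← abs_mul, ← abs_mul, abs_of_pos hη0]
        congr 1
        ring
      rw [toTorus2, toTorus2, dist_coe_unitAddCircle_eq (by rw [e1]; exact hle), e1] at hd
      exact hd
    have all : ∀ k < n + 1, |(i : ℝ) - j| * η * |ν| ^ k < r := by
      intro k
      induction k with
      | zero =>
        intro hk
        refine key 0 hk ?_
        rw [pow_zero, mul_one, hη]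
        calc _ ≤ |ν| ^ n * (r / |ν| ^ n) := by gcongr
          _ = r := by field_simp
          _ ≤ 1 / 2 := hr2
      | succ k ih =>
        intro hk
        have := ih (by omega)
        refine key (k + 1) hk ?_
        rw [pow_succ]
        nlinarith
    have := all n (by omega)
    rw [hη] at this
    have e2 : |(i : ℝ) - j| * (r / |ν| ^ n) * |ν| ^ n = |(i : ℝ) - j| * r := by field_simp
    rw [e2] at this
    nlinarith
  classical
  have hinj : Set.InjOn x (Finset.range N) := by
    intro i hi j hj h
    by_contra hij
    refine sep i j (by simpa using hi) (by simpa using hj) hij fun k _ => ?_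
    rw [h, dist_self]
    exact hr
  have hnet : IsDynNetIn (toralMap M) Set.univ {p : Torus2 × Torus2 | dist p.1 p.2 < r / 2} (n + 1)
      (((Finset.range N).image x : Finset Torus2) : Set Torus2) := by
    refine ⟨Set.subset_univ _, ?_⟩
    rw [Finset.coe_image]
    rintro _ ⟨i, hi, rfl⟩ _ ⟨j, hj, rfl⟩ hij
    rw [Function.onFun, Set.disjoint_left]
    intro y hyi hyj
    refine sep i j (by simpa using hi) (by simpa using hj) (fun h => hij (by rw [h])) fun k hk => ?_
    rw [mem_ball_dynEntourage] at hyi hyj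
    have h1 : dist ((toralMap M)^[k] (x i)) ((toralMap M)^[k] y) < r / 2 := hyi k hk
    have h2 : dist ((toralMap M)^[k] (x j)) ((toralMap M)^[k] y) < r / 2 := hyj k hk
    linarith [dist_triangle_right ((toralMap M)^[k] (x i)) ((toralMap M)^[k] (x j))
      ((toralMap M)^[k] y)]
  have hcard : |ν| ^ n ≤ ((Finset.range N).image x).card := by
    rw [Finset.card_image_of_injOn hinj, Finset.card_range, hN]
    push_cast
    exact (Nat.lt_floor_add_one _).le
  calc ENNReal.ofReal |ν| ^ n ≤ ENNReal.ofReal ((Finset.range N).image x).card := by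
        rw [← ENNReal.ofReal_pow (abs_nonneg _)]
        exact ENNReal.ofReal_le_ofReal hcard
    _ = ((((Finset.range N).image x).card : ℕ∞) : ENNReal) := by simp
    _ ≤ _ := ENat.toENNReal_mono hnet.card_le_netMaxcard

open Dynamics ExpGrowth in
/-- The entropy of the toral map of an integer matrix of determinant one with an eigenvalue `ν`
outside the unit circle is `log |ν|`. -/
theorem coverEntropy_toralMap {M : Matrix (Fin 2) (Fin 2) ℤ} (hdet : M.det = 1) (hc : M 1 0 ≠ 0)
    {ν : ℝ} (hν : 1 < |ν|) (hroot : ν ^ 2 - (M 0 0 + M 1 1) * ν + 1 = 0) :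
    coverEntropy (toralMap M) Set.univ = (Real.log |ν| : ℝ) := by
  rw [Matrix.det_fin_two] at hdet
  have hdet : (M 0 0 : ℝ) * M 1 1 - M 0 1 * M 1 0 = 1 := by exact_mod_cast hdet
  have hc : (M 1 0 : ℝ) ≠ 0 := by exact_mod_cast hc
  have hν0 : ν ≠ 0 := by
    rintro rfl
    simp at hν
    linarith
  have hlog : ENNReal.log (ENNReal.ofReal |ν|) = (Real.log |ν| : ℝ) :=
    ENNReal.log_ofReal_of_pos (by linarith)
  set a : ℝ := ((M 0 0 : ℤ) : ℝ) with ha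
  set b : ℝ := ((M 0 1 : ℤ) : ℝ) with hb
  set c : ℝ := ((M 1 0 : ℤ) : ℝ) with hcdef
  set d : ℝ := ((M 1 1 : ℤ) : ℝ) with hd
  have hmul : ∀ v : Fin 2 → ℝ, (M.map (Int.cast : ℤ → ℝ) *ᵥ v) =
      ![a * v 0 + b * v 1, c * v 0 + d * v 1] := by
    intro v
    ext i
    fin_cases i <;> simp [Matrix.mulVec, dotProduct, Fin.sum_univ_two, ha, hb, hcdef, hd]
  apply le_antisymm
  · set μ := ν⁻¹ with hμdef
    have hμν : μ * ν = 1 := inv_mul_cancel₀ hν0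
    have hμ1 : |μ| < 1 := by rw [hμdef, abs_inv]; exact inv_lt_one_of_one_lt₀ hν
    have hμroot : μ ^ 2 - (a + d) * μ + 1 = 0 := by
      have h : ν ^ 2 * (μ ^ 2 - (a + d) * μ + 1) = 0 := by
        linear_combination hroot + (μ * ν + 1 - (a + d) * ν) * hμν
      exact (mul_eq_zero.1 h).resolve_left (pow_ne_zero 2 hν0)
    have hne : ν - μ ≠ 0 := by
      intro h
      rw [sub_eq_zero] at h
      rw [h] at hν
      linarith
    -- The row vector (c, t - a) is a left eigenvector of M for each eigenvalue t. As c ≠ 0 and ν ≠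
    -- μ, the two functionals are coordinates on the plane.
    set φ : ℝ → (Fin 2 → ℝ) → ℝ := fun t v => c * v 0 + (t - a) * v 1 with hφ
    have hφeig : ∀ t, t ^ 2 - (a + d) * t + 1 = 0 → ∀ v,
        φ t (M.map (Int.cast : ℤ → ℝ) *ᵥ v) = t * φ t v := by
      intro t ht v
      rw [hmul]
      simp only [hφ, Matrix.cons_val_zero, Matrix.cons_val_one]
      linear_combination (-v 1) * ht - v 1 * hdet
    have hφsub : ∀ t v w, φ t (v - w) = φ t v - φ t w := by
      intro t v w
      simp only [hφ, Pi.sub_apply]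
      ring
    have hφbd : ∀ t v, (∀ i, |v i| ≤ 1) → |φ t v| ≤ |c| + |t - a| := by
      intro t v hv
      refine (abs_add_le _ _).trans ?_
      rw [abs_mul, abs_mul]
      exact add_le_add (mul_le_of_le_one_right (abs_nonneg _) (hv 0))
        (mul_le_of_le_one_right (abs_nonneg _) (hv 1))
    have h1 : ∀ v : Fin 2 → ℝ, v 1 = (ν - μ)⁻¹ * (φ ν v - φ μ v) := by
      intro v
      simp only [hφ]
      field_simp
      ring
    have h0 : ∀ v : Fin 2 → ℝ, v 0 = c⁻¹ * (φ ν v - (ν - a) * v 1) := by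
      intro v
      simp only [hφ]
      field_simp
      ring
    rw [coverEntropy_eq_iSup_basis Metric.uniformity_basis_dist]
    refine iSup₂_le fun ρ hρ => ?_
    set K := |(ν - μ)⁻¹| + |c⁻¹| * (1 + |ν - a| * |(ν - μ)⁻¹|) with hK
    have hKpos : 0 < K := by
      have : 0 < |(ν - μ)⁻¹| := abs_pos.2 (inv_ne_zero hne)
      positivity
    have hv1 : ∀ v : Fin 2 → ℝ, |v 1| ≤ |(ν - μ)⁻¹| * (|φ ν v| + |φ μ v|) := by
      intro v
      rw [h1 v, abs_mul]
      gcongr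
      exact abs_sub _ _
    have hv0 : ∀ v : Fin 2 → ℝ, |v 0| ≤
        |c⁻¹| * (1 + |ν - a| * |(ν - μ)⁻¹|) * (|φ ν v| + |φ μ v|) := by
      intro v
      calc |v 0| = |c⁻¹| * |φ ν v - (ν - a) * v 1| := by rw [h0 v, abs_mul]
        _ ≤ |c⁻¹| * (|φ ν v| + |ν - a| * |v 1|) := by
          gcongr
          rw [← abs_mul]
          exact abs_sub _ _
        _ ≤ |c⁻¹| * ((|φ ν v| + |φ μ v|) +
              |ν - a| * (|(ν - μ)⁻¹| * (|φ ν v| + |φ μ v|))) := by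
          gcongr
          · linarith [abs_nonneg (φ μ v)]
          · exact hv1 v
        _ = _ := by ring
    obtain ⟨C, -, hC⟩ := coverMincard_toralMap_le hν hμ1.le (hφeig ν hroot) (hφeig μ hμroot)
      (hφsub ν) (hφsub μ)
      (fun y z => ⟨![c⁻¹ * (y - (ν - a) * ((ν - μ)⁻¹ * (y - z))), (ν - μ)⁻¹ * (y - z)], by
        simp only [hφ, Matrix.cons_val_zero, Matrix.cons_val_one]
        constructor <;> field_simp <;> ring⟩)
      (K := K) (B := |c| + |ν - a| + |μ - a|) hKpos (by positivity)
      (fun v i => by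
        have hs : 0 ≤ |φ ν v| + |φ μ v| := by positivity
        have p1 : 0 ≤ |(ν - μ)⁻¹| * (|φ ν v| + |φ μ v|) := by positivity
        have p2 : 0 ≤ |c⁻¹| * (1 + |ν - a| * |(ν - μ)⁻¹|) * (|φ ν v| + |φ μ v|) := by positivity
        rw [hK, add_mul]
        fin_cases i
        · exact (hv0 v).trans (by linarith)
        · exact (hv1 v).trans (by linarith))
      (fun v hv => (hφbd ν v hv).trans (by linarith [abs_nonneg (μ - a)]))
      (fun v hv => (hφbd μ v hv).trans (by linarith [abs_nonneg (ν - a)])) hρ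
    rw [← hlog, ← expGrowthSup_pow]
    exact expGrowthSup_le_of_eventually_le ENNReal.ofReal_ne_top (Eventually.of_forall hC)
  · set e : Fin 2 → ℝ := ![(ν - d) / c, 1] with he
    have heig : M.map (Int.cast : ℤ → ℝ) *ᵥ e = ν • e := by
      rw [hmul]
      ext i
      fin_cases i
      · simp [he]
        field_simp
        linear_combination -hroot - hdet
      · simp [he]
        field_simp
        ring
    set r := 1 / (2 * |ν|) with hr
    have hr0 : 0 < r := by positivity
    have hrν : |ν| * r ≤ 1 / 2 := by rw [hr]; field_simp; exact le_rfl
    refine le_trans ?_ (netEntropyEntourage_le_coverEntropy (toralMap M) Set.univ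
      (Metric.dist_mem_uniformity (half_pos hr0)))
    rw [← hlog, ← expGrowthSup_pow]
    -- The constant factor |ν| absorbs the loss of one iterate in the net estimate.
    refine expGrowthSup_le_of_eventually_le (b := ENNReal.ofReal |ν|) ENNReal.ofReal_ne_top ?_
    filter_upwards [eventually_ge_atTop 1] with n hn
    obtain ⟨n, rfl⟩ := Nat.exists_eq_add_of_le' hn
    rw [pow_succ']
    gcongr
    exact le_netMaxcard_toralMap hν heig (i₀ := 1) rfl hr0 hrν n

/-! ### Elements of the modular group fixing an irrational number -/

theorem toPSL2Z_eq_iff {M N : Matrix.SpecialLinearGroup (Fin 2) ℤ} :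
    toPSL2Z M = toPSL2Z N ↔ N = M ∨ N = -M := by
  rw [toPSL2Z, QuotientGroup.mk'_eq_mk']
  constructor
  · rintro ⟨Z, hZ, rfl⟩
    obtain ⟨r, hr, hrZ⟩ := Matrix.SpecialLinearGroup.mem_center_iff.1 hZ
    rw [Fintype.card_fin, sq_eq_one_iff] at hr
    rcases hr with rfl | rfl
    · left
      have : Z = 1 := by
        apply Subtype.ext
        rw [← hrZ]
        simp
      rw [this, mul_one]
    · right
      have : Z = -1 := by
        apply Subtype.ext
        rw [← hrZ]
        simp
      rw [this, mul_neg, mul_one]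
  · rintro (rfl | rfl)
    · exact ⟨1, one_mem _, mul_one _⟩
    · refine ⟨-1, ?_, by rw [mul_neg, mul_one]⟩
      rw [Matrix.SpecialLinearGroup.mem_center_iff]
      exact ⟨-1, by simp, by simp⟩

theorem toPSL2Z_surjective : Function.Surjective toPSL2Z :=
  QuotientGroup.mk'_surjective _

theorem isHyperbolic_toPSL2Z {M : Matrix.SpecialLinearGroup (Fin 2) ℤ} :
    PSL2Z.IsHyperbolic (toPSL2Z M) ↔ (M : Matrix (Fin 2) (Fin 2) ℤ).IsHyperbolic := by
  refine ⟨?_, fun h => ⟨M, rfl, h⟩⟩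
  rintro ⟨N, hN, h⟩
  rcases toPSL2Z_eq_iff.1 hN with rfl | rfl
  · exact h
  · rw [Matrix.SpecialLinearGroup.coe_neg]
    exact Matrix.isHyperbolic_neg_iff.2 h

theorem fixes_toPSL2Z {θ : ℝ} (hθ : Irrational θ) {M : Matrix.SpecialLinearGroup (Fin 2) ℤ} :
    PSL2Z.Fixes (toPSL2Z M) θ ↔ M ∈ lineStabilizer θ := by
  have key : ∀ N : Matrix.SpecialLinearGroup (Fin 2) ℤ,
      ((N 0 0 : ℝ) * θ + (N 0 1 : ℝ)) / ((N 1 0 : ℝ) * θ + (N 1 1 : ℝ)) = θ ↔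
        N ∈ lineStabilizer θ := by
    intro N
    rw [mem_lineStabilizer, ← multiplier, div_eq_iff (multiplier_ne_zero hθ N)]
  refine ⟨?_, fun h => ⟨M, rfl, (key M).2 h⟩⟩
  rintro ⟨N, hN, h⟩
  rw [key] at h
  rcases toPSL2Z_eq_iff.1 hN with rfl | rfl
  · exact h
  · exact neg_mem_lineStabilizer h

theorem toPSL2Z_eq_iff_abs_multiplier_eq {θ : ℝ} (hθ : Irrational θ)
    {M N : Matrix.SpecialLinearGroup (Fin 2) ℤ} (hM : M ∈ lineStabilizer θ)
    (hN : N ∈ lineStabilizer θ) :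
    toPSL2Z M = toPSL2Z N ↔ |multiplier M θ| = |multiplier N θ| := by
  rw [toPSL2Z_eq_iff]
  constructor
  · rintro (rfl | rfl)
    · rfl
    · rw [multiplier_neg, abs_neg]
  · intro h
    rcases abs_eq_abs.1 h with h | h
    · exact Or.inl (eq_of_multiplier_eq hθ hN hM h.symm)
    · right
      refine eq_of_multiplier_eq hθ hN (neg_mem_lineStabilizer hM) ?_
      rw [multiplier_neg, h, neg_neg]

theorem abs_multiplier_zpow {θ : ℝ} {M : Matrix.SpecialLinearGroup (Fin 2) ℤ}
    (hM : M ∈ lineStabilizer θ) (j : ℤ) : |multiplier (M ^ j) θ| = |multiplier M θ| ^ j := by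
  have := map_zpow (multiplierHom θ) ⟨M, hM⟩ j
  rw [← abs_zpow]
  exact congrArg abs this

/-- The factor a - c θ is the other eigenvalue, trace minus multiplier. -/
theorem multiplier_mul_eq_one {θ : ℝ} {M : Matrix.SpecialLinearGroup (Fin 2) ℤ}
    (hM : M ∈ lineStabilizer θ) : (M 0 0 - M 1 0 * θ) * multiplier M θ = 1 := by
  rw [mem_lineStabilizer] at hM
  have := det_cast_eq_one M
  unfold multiplier at hM ⊢
  linear_combination this + (M 1 0 : ℝ) * hM

/-- The multiplier is a root of the characteristic polynomial. -/
theorem multiplier_root {θ : ℝ} {M : Matrix.SpecialLinearGroup (Fin 2) ℤ}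
    (hM : M ∈ lineStabilizer θ) :
    multiplier M θ ^ 2 - (M 0 0 + M 1 1) * multiplier M θ + 1 = 0 := by
  have h := multiplier_mul_eq_one hM
  have e : (M 1 0 : ℝ) * θ = multiplier M θ - M 1 1 := by rw [multiplier]; ring
  rw [e] at h
  linear_combination -h

theorem trace_sq_sub_four {θ : ℝ} (hθ : Irrational θ) {M : Matrix.SpecialLinearGroup (Fin 2) ℤ}
    (hM : M ∈ lineStabilizer θ) :
    (((M : Matrix (Fin 2) (Fin 2) ℤ).discr : ℤ) : ℝ) =
      (multiplier M θ - (multiplier M θ)⁻¹) ^ 2 := by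
  have h0 := multiplier_ne_zero hθ M
  have h := multiplier_root hM
  have ht : (M 0 0 + M 1 1 : ℝ) = multiplier M θ + (multiplier M θ)⁻¹ := by
    field_simp
    linarith
  rw [Matrix.discr_fin_two, M.det_coe, Matrix.trace_fin_two]
  push_cast
  rw [ht]
  field_simp
  ring

theorem isHyperbolic_iff_abs_multiplier_ne_one {θ : ℝ} (hθ : Irrational θ)
    {M : Matrix.SpecialLinearGroup (Fin 2) ℤ} (hM : M ∈ lineStabilizer θ) :
    (M : Matrix (Fin 2) (Fin 2) ℤ).IsHyperbolic ↔ |multiplier M θ| ≠ 1 := by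
  have h0 := multiplier_ne_zero hθ M
  have h : (M : Matrix (Fin 2) (Fin 2) ℤ).IsHyperbolic ↔
      0 < (multiplier M θ - (multiplier M θ)⁻¹) ^ 2 := by
    rw [← trace_sq_sub_four hθ hM]
    exact Int.cast_pos.symm
  rw [h, sq_pos_iff, ne_eq, ne_eq, not_iff_not, sub_eq_zero, ← mul_eq_one_iff_eq_inv₀ h0, ← sq,
    ← sq_abs, pow_eq_one_iff_of_nonneg (abs_nonneg _) two_ne_zero]

theorem apply_one_zero_ne_zero {θ : ℝ} {M : Matrix.SpecialLinearGroup (Fin 2) ℤ}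
    (hM : M ∈ lineStabilizer θ) (h : |multiplier M θ| ≠ 1) : M 1 0 ≠ 0 := by
  intro hc
  have h1 := multiplier_root hM
  have h2 : multiplier M θ = M 1 1 := by rw [multiplier, hc]; simp
  have h3 := det_cast_eq_one M
  rw [h2] at h1 h
  have h4 : M 1 1 ∣ 1 := ⟨M 0 0, by
    rw [hc] at h3
    have h3 : (M 0 0 : ℝ) * M 1 1 = 1 := by simpa using h3
    have : M 0 0 * M 1 1 = 1 := by exact_mod_cast h3
    linarith⟩
  rcases Int.isUnit_iff.1 (isUnit_of_dvd_one h4) with h5 | h5 <;> rw [h5] at h <;> simp at h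

/-- A matrix commuting with a hyperbolic element of the stabilizer belongs to the stabilizer. -/
theorem mem_lineStabilizer_of_commute {θ : ℝ} {M H : Matrix.SpecialLinearGroup (Fin 2) ℤ}
    (hM : M ∈ lineStabilizer θ) (h : |multiplier M θ| ≠ 1) (hcomm : M * H = H * M) :
    H ∈ lineStabilizer θ := by
  have hc := apply_one_zero_ne_zero hM h
  have hc' : (M 1 0 : ℝ) ≠ 0 := by exact_mod_cast hc
  have e : ∀ i j, (M i 0 : ℝ) * H 0 j + M i 1 * H 1 j = H i 0 * M 0 j + H i 1 * M 1 j := by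
    intro i j
    have := congrFun (congrFun (congrArg Subtype.val hcomm) i) j
    simp only [Matrix.SpecialLinearGroup.coe_mul, Matrix.mul_apply, Fin.sum_univ_two] at this
    exact_mod_cast this
  have e0 := e 1 0
  have e1 := e 1 1
  rw [mem_lineStabilizer] at hM ⊢
  -- With v = (θ, 1), the bottom row of M H v = H M v reads c (Hv)₀ + d (Hv)₁ = (c θ + d) (Hv)₁;
  -- cancel c.
  refine mul_left_cancel₀ hc' ?_
  unfold multiplier at hM ⊢
  linear_combination θ * e0 + e1 + (H 1 0 : ℝ) * hM

theorem isHyperbolicToral_of_mem_lineStabilizer {θ : ℝ} (hθ : Irrational θ)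
    {M : Matrix.SpecialLinearGroup (Fin 2) ℤ} (hM : M ∈ lineStabilizer θ)
    (h : |multiplier M θ| ≠ 1) : IsHyperbolicToral M := by
  intro z hz hz1
  have h0 := multiplier_ne_zero hθ M
  have hroot := multiplier_root hM
  rw [Matrix.mem_spectrum_iff_isRoot_charpoly, Matrix.charpoly_fin_two] at hz
  have hdet : ((M : Matrix (Fin 2) (Fin 2) ℤ).map (Int.cast : ℤ → ℂ)).det = 1 := by
    have := det_cast_eq_one M
    rw [Matrix.det_fin_two]
    simp only [Matrix.map_apply]
    exact_mod_cast this
  rw [hdet, Matrix.trace_fin_two] at hz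
  simp only [Polynomial.IsRoot.def, Matrix.map_apply, Polynomial.eval_add, Polynomial.eval_sub,
    Polynomial.eval_mul, Polynomial.eval_pow, Polynomial.eval_X, Polynomial.eval_C] at hz
  set l := multiplier M θ
  have hroot' : (l : ℂ) ^ 2 - ((M 0 0 : ℤ) + (M 1 1 : ℤ) : ℂ) * l + 1 = 0 := by exact_mod_cast hroot
  have hl : (l : ℂ) ≠ 0 := by exact_mod_cast h0
  have hfac : (z - l) * (z * l - 1) = 0 := by
    linear_combination (l : ℂ) * hz - z * hroot'
  rcases mul_eq_zero.1 hfac with h' | h'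
  · rw [sub_eq_zero] at h'
    rw [h', Complex.norm_real] at hz1
    exact h hz1
  · rw [sub_eq_zero] at h'
    have := congrArg norm h'
    rw [norm_mul, hz1, one_mul, Complex.norm_real, norm_one] at this
    exact h this

theorem torusEntropy_toralAutomorphism {θ : ℝ} (hθ : Irrational θ)
    {M : Matrix.SpecialLinearGroup (Fin 2) ℤ} (hM : M ∈ lineStabilizer θ)
    (h : |multiplier M θ| ≠ 1) :
    torusEntropy (toralAutomorphism M) = (|Real.log (|multiplier M θ|)| : ℝ) := by
  have h0 := multiplier_ne_zero hθ M
  have hroot := multiplier_root hM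
  have hc := apply_one_zero_ne_zero hM h
  change Dynamics.coverEntropy (toralMap M) Set.univ = _
  rcases lt_or_gt_of_ne h with h | h
  -- Here the expanding eigenvalue is the inverse of the multiplier.
  · have h1 : 1 < |(multiplier M θ)⁻¹| := by
      rw [abs_inv]
      exact (one_lt_inv₀ (abs_pos.2 h0)).2 h
    rw [coverEntropy_toralMap M.det_coe hc h1 (by field_simp; linear_combination hroot), abs_inv,
      Real.log_inv, abs_of_nonpos (Real.log_nonpos (abs_nonneg _) h.le)]
  · rw [coverEntropy_toralMap M.det_coe hc h hroot, abs_of_nonneg (Real.log_nonneg h.le)]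

theorem PSL2Z.IsHyperbolic.inv {γ : PSL2Z} (h : PSL2Z.IsHyperbolic γ) :
    PSL2Z.IsHyperbolic γ⁻¹ := by
  obtain ⟨M, rfl⟩ := toPSL2Z_surjective γ
  rw [← map_inv, isHyperbolic_toPSL2Z] at *
  unfold Matrix.IsHyperbolic at *
  rw [Matrix.discr_fin_two, Matrix.SpecialLinearGroup.det_coe] at *
  rw [Matrix.SpecialLinearGroup.coe_inv, Matrix.adjugate_fin_two, Matrix.trace_fin_two_of]
  rw [Matrix.trace_fin_two] at h
  linarith

theorem PSL2Z.IsPrimeHyperbolic.inv {γ : PSL2Z} (h : PSL2Z.IsPrimeHyperbolic γ) :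
    PSL2Z.IsPrimeHyperbolic γ⁻¹ := by
  refine ⟨h.1.inv, fun η k hη hk => ?_⟩
  have := h.2 η (-k) hη (by rw [_root_.zpow_neg, ← hk, inv_inv])
  omega

/-- If the multipliers of the stabilizer of `θ` are the powers of that of `A`, up to sign, then
`A` represents the prime hyperbolic element associated to `θ`, which is unique up to inversion. -/
theorem isPrimeHyperbolicOf_iff {θ : ℝ} (hθ : Irrational θ)
    {A : Matrix.SpecialLinearGroup (Fin 2) ℤ} (hA : A ∈ lineStabilizer θ)
    (hA1 : 1 < |multiplier A θ|)
    (hgen : ∀ M ∈ lineStabilizer θ, ∃ j : ℤ, |multiplier M θ| = |multiplier A θ| ^ j) :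
    PSL2Z.IsPrimeHyperbolicOf (toPSL2Z A) θ ∧ ∀ η : PSL2Z,
      PSL2Z.IsPrimeHyperbolicOf η θ ↔ η = toPSL2Z A ∨ η = (toPSL2Z A)⁻¹ := by
  have hhyp : PSL2Z.IsHyperbolic (toPSL2Z A) :=
    isHyperbolic_toPSL2Z.2 ((isHyperbolic_iff_abs_multiplier_ne_one hθ hA).2 hA1.ne')
  have hpow : ∀ M ∈ lineStabilizer θ, ∃ j : ℤ, toPSL2Z M = toPSL2Z A ^ j := by
    intro M hM
    obtain ⟨j, hj⟩ := hgen M hM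
    refine ⟨j, ?_⟩
    rw [← map_zpow, toPSL2Z_eq_iff_abs_multiplier_eq hθ hM (zpow_mem hA j),
      abs_multiplier_zpow hA, hj]
  have hprime : PSL2Z.IsPrimeHyperbolic (toPSL2Z A) := by
    refine ⟨hhyp, fun η k _ hk => ?_⟩
    obtain ⟨H, rfl⟩ := toPSL2Z_surjective η
    rw [← map_zpow] at hk
    -- A = ±H^k commutes with H, so H preserves the line as well. Its multiplier is then, up to
    -- sign, the j-th power of that of A, which forces j k = 1.
    have hcomm : A * H = H * A := by
      have hHk : (H ^ k) * H = H * H ^ k := by rw [← _root_.zpow_add_one, ← _root_.zpow_one_add, add_comm]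
      rcases toPSL2Z_eq_iff.1 hk with h | h
      · rw [← h, hHk]
      · rw [← neg_inj, ← neg_mul, ← mul_neg, ← h, hHk]
    have hH := mem_lineStabilizer_of_commute hA hA1.ne' hcomm
    obtain ⟨j, hj⟩ := hgen H hH
    rw [toPSL2Z_eq_iff_abs_multiplier_eq hθ hA (zpow_mem hH k), abs_multiplier_zpow hH, hj,
      ← _root_.zpow_mul] at hk
    have : j * k = 1 := by
      have := zpow_right_injective₀ (by linarith) hA1.ne' ((zpow_one _).trans hk)
      exact this.symm
    exact Int.isUnit_iff.1 (IsUnit.of_mul_eq_one j (by linarith))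
  have hfix := (fixes_toPSL2Z hθ).2 hA
  refine ⟨⟨hprime, hfix⟩, fun η => ⟨?_, ?_⟩⟩
  · rintro ⟨h1, h2⟩
    obtain ⟨M, rfl⟩ := toPSL2Z_surjective η
    obtain ⟨j, hj⟩ := hpow M ((fixes_toPSL2Z hθ).1 h2)
    rcases h1.2 _ j hhyp hj with rfl | rfl
    · left; rw [hj, zpow_one]
    · right; rw [hj, _root_.zpow_neg_one]
  · rintro (rfl | rfl)
    · exact ⟨hprime, hfix⟩
    · refine ⟨hprime.inv, ?_⟩
      rw [← map_inv, fixes_toPSL2Z hθ]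
      exact inv_mem hA

/-! ### Assembly of the main theorem. -/

theorem theorem3 (θ : ℝ) (hθ : Irrational θ) (hdeg : (minpoly ℚ θ).natDegree = 2) :
    -- `p` is the minimal period of the continued fraction of `θ`, `β` its Lévy constant
    ∃ (p : ℕ) (β : ℝ), IsLeast {l : ℕ | IsEventualCFPeriod θ l} p ∧ HasLevyConstant θ β ∧
      -- the prime hyperbolic element associated to `θ` exists, uniquely up to inversion
      (∃ γ : PSL2Z, PSL2Z.IsPrimeHyperbolicOf γ θ ∧
        ∀ η : PSL2Z, PSL2Z.IsPrimeHyperbolicOf η θ ↔ η = γ ∨ η = γ⁻¹) ∧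
      -- each matrix representing it induces a hyperbolic toral automorphism of entropy `ℓ β`
      ∀ M : Matrix.SpecialLinearGroup (Fin 2) ℤ, PSL2Z.IsPrimeHyperbolicOf (toPSL2Z M) θ →
        IsHyperbolicToral M ∧
        torusEntropy (toralAutomorphism M) =
          ((((if Even p then p else 2 * p : ℕ) : ℝ) * β : ℝ) : EReal) := by
  obtain ⟨p, k, hp, hk, hdvd⟩ := exists_minimal_period hθ hdeg
  have hp0 : 0 < p := hp.1.1
  set l := if Even p then p else 2 * p with hl
  have hl0 : 0 < l := by rw [hl]; split_ifs <;> omega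
  have hleven : Even l := by
    rw [hl]
    split_ifs with h
    · exact h
    · exact even_two_mul p
  have hlper : ∀ n ≥ k, completeQuotient θ (n + l) = completeQuotient θ n := by
    intro n hn
    rw [hl]
    split_ifs
    · exact hk n hn
    · rw [mul_comm]
      exact completeQuotient_add_mul hk 2 hn
  -- For odd p, an even multiple of p is a multiple of 2p.
  have hldvd : ∀ n i, Even i → completeQuotient θ (n + i) = completeQuotient θ n → l ∣ i := by
    intro n i hi h
    have h1 := hdvd n i h
    rw [hl]
    split_ifs with hev
    · exact h1
    · have hcop : Nat.Coprime 2 p := (Nat.coprime_two_left).2 (Nat.not_even_iff_odd.1 hev)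
      exact hcop.mul_dvd_of_dvd_of_dvd hi.two_dvd h1
  set ε := quotientProd θ (k + l) / quotientProd θ k with hε
  have hε1 : 1 < ε := (one_lt_div (quotientProd_pos hθ k)).2 (quotientProd_lt hθ k hl0)
  obtain ⟨A, hA, hAε⟩ := exists_multiplier_eq hθ hleven (hlper k le_rfl)
  rw [← hε] at hAε
  obtain ⟨hprime, huniq⟩ := isPrimeHyperbolicOf_iff hθ hA (hAε ▸ hε1) (fun M hM => by
    rw [hAε]
    exact exists_multiplier_eq_zpow hθ hlper hldvd hM)
  refine ⟨p, Real.log ε / l, hp, hasLevyConstant hθ hl0 hlper, ⟨toPSL2Z A, hprime, huniq⟩,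
    fun M hM => ?_⟩
  have hMfix : M ∈ lineStabilizer θ := (fixes_toPSL2Z hθ).1 hM.2
  have hne := (isHyperbolic_iff_abs_multiplier_ne_one hθ hMfix).1 (isHyperbolic_toPSL2Z.1 hM.1.1)
  refine ⟨isHyperbolicToral_of_mem_lineStabilizer hθ hMfix hne, ?_⟩
  rw [torusEntropy_toralAutomorphism hθ hMfix hne, mul_div_cancel₀ _ (by positivity)]
  have hlog := Real.log_nonneg hε1.le
  -- M represents the generator or its inverse; inversion only changes the sign of the logarithm.
  rcases (huniq _).1 hM with h | h
  · rw [(toPSL2Z_eq_iff_abs_multiplier_eq hθ hMfix hA).1 h, hAε, abs_of_nonneg hlog]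
  · rw [← map_inv] at h
    rw [(toPSL2Z_eq_iff_abs_multiplier_eq hθ hMfix (inv_mem hA)).1 h, ← _root_.zpow_neg_one,
      abs_multiplier_zpow hA, hAε, _root_.zpow_neg_one, Real.log_inv, abs_neg, abs_of_nonneg hlog]
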